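/- Let $\Sigma_4=\{0,1,2,3\}$. A factor of a finite or infinite word is a finite contiguous subword of it. A word over $\Sigma_4$ is a *Dean word* if it is reduced (none of $02,20,13,31$ is a factor) and square-free (no factor has the form $vv$ with $v$ nonempty). A finite word $f$ has period $p\ge 1$ if any two letters of $f$ at distance $p$ agree, and it is then a repetition of exponent $|f|/p$. A word is *$\beta$-free* (resp. *$\beta^+$-free*) if no factor of it is a repetition of exponent at least $\beta$ (resp. more than $\beta$). A word is *$d$-directed* if for every factor $f$ of length $d$ the reverse of $f$ is not a factor. Let $h:\Sigma_4^*\to\Sigma_4^*$ be the morphism that maps each letter to the concatenation of the rows given for it: $$\begin{array}{rl} 0\to{}&\mathtt{01032101230321030123210123032123010323012103012321012303210301232103230121032123010321}\\ &\mathtt{01230321230103230121030123210123032123010321012303210301232103230121030123210123032123}\\ &\mathtt{01032301210321230103210123032103012321012303212301032301210301232103230121032123010321}\\ &\mathtt{01230321230103230121030123210123032123010321012303210301232103230121032123010323012103}\\ &\mathtt{01232101230321230103230121032123010321012303210301232103230121030123210123032123010323}\\ &\mathtt{01210301232103230121032123010321012303212301032301210301232101230321030123210323012103}\\ &\mathtt{212301032301210301232101230321230103230121032123}\\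 1\to{}&\mathtt{01032101230321030123210123032123010323012103012321012303210301232103230121032123010321}\\ &\mathtt{01230321230103230121030123210123032123010321012303210301232103230121030123210123032123}\\ &\mathtt{01032301210321230103210123032103012321012303212301032301210301232103230121032123010321}\\ &\mathtt{01230321230103230121030123210123032103012321032301210321230103230121030123210123032123}\\ &\mathtt{01032301210321230103210123032103012321032301210301232101230321230103230121030123210323}\\ &\mathtt{01210321230103210123032123010323012103012321012303212301032101230321030123210323012103}\\ &\mathtt{212301032301210301232101230321230103230121032123}\\ 2\to{}&\mathtt{01032101230321030123210123032123010323012103012321012303210301232103230121032123010321}\\ &\mathtt{01230321230103230121030123210123032123010321012303210301232103230121030123210123032123}\\ &\mathtt{01032301210321230103210123032103012321012303212301032301210301232101230321030123210323}\\ &\mathtt{01210321230103230121030123210123032123010323012103212301032101230321030123210323012103}\\ &\mathtt{01232101230321230103230121030123210323012103212301032101230321230103230121030123210123}\\ &\mathtt{03210301232103230121032123010323012103012321012303212301032101230321030123210323012103}\\ &\mathtt{012321012303212301032301210301232103230121032123}\\ 3\to{}&\mathtt{01032101230321030123210123032123010323012103012321012303210301232103230121032123010321}\\ &\mathtt{01230321230103230121030123210123032123010321012303210301232103230121030123210123032123}\\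 &\mathtt{01032301210321230103210123032103012321012303212301032301210301232101230321030123210323}\\ &\mathtt{01210321230103230121030123210123032123010321012303210301232103230121030123210123032123}\\ &\mathtt{01032301210301232103230121032123010321012303212301032301210301232101230321030123210323}\\ &\mathtt{01210321230103230121030123210123032123010323012103212301032101230321030123210323012103}\\ &\mathtt{012321012303212301032301210301232103230121032123}\\ \end{array}$$ Then the following hold. 1. $h$ is $564$-uniform, i.e. $|h(a)|=564$ for every $a\in\Sigma_4$. 2. There exists an infinite $\frac{27}{16}^+$-free $10$-directed Dean word; moreover such a word can be obtained as $h(u)$ for some infinite $\frac75^+$-free word $u$ over $\Sigma_4$. 3. For every finite or infinite $\frac75^+$-free word $u$ over $\Sigma_4$, the word $h(u)$ is a $\frac{27}{16}^+$-free $10$-directed Dean word. 4. Every $\frac{27}{16}$-free $11$-directed Dean word $w$ is finite and satisfies $|w|<129$. -/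

import Mathlib

/-- The set of factors (finite contiguous subwords) of a finite word. -/
def wordFactors {α : Type*} (w : List α) : Set (List α) := {f | f <:+: w}

/-- The prefix of length `n` of an infinite word. -/
def prefixOf {α : Type*} (w : ℕ → α) (n : ℕ) : List α := (List.range n).map w

/-- The set of factors (finite contiguous subwords) of an infinite word. -/
def infFactors {α : Type*} (w : ℕ → α) : Set (List α) :=
  {f | ∃ i n : ℕ, f = prefixOf (fun j => w (i + j)) n}

/-- `p` is a period of the finite word `f`: letters at distance `p` agree. -/
def HasPeriod {α : Type*} (f : List α) (p : ℕ) : Prop :=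
  ∀ i, i + p < f.length → f[i]? = f[i + p]?

/-
The properties below are properties of a finite or infinite word that depend on its factors only.
They are stated for the set `L` of factors of the word.
-/

/-- `β`-free: no factor is a repetition of exponent (length over period) at least `β`. -/
def IsFreeWord {α : Type*} (β : ℚ) (L : Set (List α)) : Prop :=
  ∀ f ∈ L, ∀ p : ℕ, 0 < p → HasPeriod f p → (f.length : ℚ) / p < β

/-- `β⁺`-free: no factor is a repetition of exponent (length over period) more than `β`. -/
def IsPlusFreeWord {α : Type*} (β : ℚ) (L : Set (List α)) : Prop :=
  ∀ f ∈ L, ∀ p : ℕ, 0 < p → HasPeriod f p → (f.length : ℚ) / p ≤ β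

/-- No factor is of the form `vv` with `v` nonempty. -/
def IsSquareFreeWord {α : Type*} (L : Set (List α)) : Prop :=
  ∀ v : List α, v ≠ [] → v ++ v ∉ L

/-- Reduced words over `{0, 1, 2, 3}`, where `0, 2` are mutually inverse and so are `1, 3`. -/
def IsReducedWord (L : Set (List (Fin 4))) : Prop :=
  [0, 2] ∉ L ∧ [2, 0] ∉ L ∧ [1, 3] ∉ L ∧ [3, 1] ∉ L

/-- Dean words: the square-free reduced words. -/
def IsDeanWord (L : Set (List (Fin 4))) : Prop := IsReducedWord L ∧ IsSquareFreeWord L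

/-- `d`-directed: the reverse of a factor of length `d` is never a factor. -/
def IsDirectedWord {α : Type*} (d : ℕ) (L : Set (List α)) : Prop :=
  ∀ f ∈ L, f.length = d → f.reverse ∉ L

/-- The image of a finite word under the morphism given by the images of the letters. -/
def wordImage {α β : Type*} (h : α → List β) (u : List α) : List β := u.flatMap h

/-- The image of an infinite word under a morphism that maps no letter to the empty word:
its letter at position `n` is read off the image of the prefix of length `n + 1`, which has length
at least `n + 1` (the default value of `getD` is never used). -/
def infImage {α : Type*} (h : α → List (Fin 4)) (u : ℕ → α) : ℕ → Fin 4 :=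
  fun n => (wordImage h (prefixOf u (n + 1))).getD n 0

/-- The word formed by the last `k` decimal digits (all in `{0, 1, 2, 3}` below) of a numeral. -/
def digitWord : ℕ → ℕ → List (Fin 4)
  | 0, _ => []
  | k + 1, n => digitWord k (n / 10) ++ [Fin.ofNat 4 (n % 10)]

/-- The 564-uniform morphism. -/
def deanMorphism : Fin 4 → List (Fin 4)
  | 0 =>
      digitWord 86 01032101230321030123210123032123010323012103012321012303210301232103230121032123010321 ++
      digitWord 86 01230321230103230121030123210123032123010321012303210301232103230121030123210123032123 ++
      digitWord 86 01032301210321230103210123032103012321012303212301032301210301232103230121032123010321 ++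
      digitWord 86 01230321230103230121030123210123032123010321012303210301232103230121032123010323012103 ++
      digitWord 86 01232101230321230103230121032123010321012303210301232103230121030123210123032123010323 ++
      digitWord 86 01210301232103230121032123010321012303212301032301210301232101230321030123210323012103 ++
      digitWord 48 212301032301210301232101230321230103230121032123
  | 1 =>
      digitWord 86 01032101230321030123210123032123010323012103012321012303210301232103230121032123010321 ++
      digitWord 86 01230321230103230121030123210123032123010321012303210301232103230121030123210123032123 ++
      digitWord 86 01032301210321230103210123032103012321012303212301032301210301232103230121032123010321 ++
      digitWord 86 01230321230103230121030123210123032103012321032301210321230103230121030123210123032123 ++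
      digitWord 86 01032301210321230103210123032103012321032301210301232101230321230103230121030123210323 ++
      digitWord 86 01210321230103210123032123010323012103012321012303212301032101230321030123210323012103 ++
      digitWord 48 212301032301210301232101230321230103230121032123
  | 2 =>
      digitWord 86 01032101230321030123210123032123010323012103012321012303210301232103230121032123010321 ++
      digitWord 86 01230321230103230121030123210123032123010321012303210301232103230121030123210123032123 ++
      digitWord 86 01032301210321230103210123032103012321012303212301032301210301232101230321030123210323 ++
      digitWord 86 01210321230103230121030123210123032123010323012103212301032101230321030123210323012103 ++
      digitWord 86 01232101230321230103230121030123210323012103212301032101230321230103230121030123210123 ++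
      digitWord 86 03210301232103230121032123010323012103012321012303212301032101230321030123210323012103 ++
      digitWord 48 012321012303212301032301210301232103230121032123
  | 3 =>
      digitWord 86 01032101230321030123210123032123010323012103012321012303210301232103230121032123010321 ++
      digitWord 86 01230321230103230121030123210123032123010321012303210301232103230121030123210123032123 ++
      digitWord 86 01032301210321230103210123032103012321012303212301032301210301232101230321030123210323 ++
      digitWord 86 01210321230103230121030123210123032123010321012303210301232103230121030123210123032123 ++
      digitWord 86 01032301210301232103230121032123010321012303212301032301210301232101230321030123210323 ++
      digitWord 86 01210321230103230121030123210123032123010323012103212301032101230321030123210323012103 ++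
      digitWord 48 012321012303212301032301210301232103230121032123

/-!
All statements are reduced to matches `Matches w i p l`: the `l` letters of `w` from position `i` on
agree with those at distance `p`. A word has a factor of length `p + l` with period `p` exactly if it
has such a match, so that `7/5⁺`-freeness says `5 l ≤ 2 p` for all matches and `27/16⁺`-freeness says
`16 l ≤ 11 p`. Square-freeness is a consequence of `27/16⁺`-freeness.

*Images of `7/5⁺`-free words* (`le_of_matches_deanImage`). A match of length at least 594 in an image
contains a marker word which occurs at one position modulo 564 only (`dvd_of_matches_deanImage`).
Hence its period is `564 k`, and it comes from a match of `j` letters with period `k` in the preimage.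
The partially covered blocks at the two ends contribute at most `86 + 301` letters if their letters
differ, as images of distinct letters have common suffixes of length at most 86 and common prefixes of
length at most 301. So `l ≤ 564 j + 387` and `5 j ≤ 2 k`, which gives `16 l ≤ 11 p`; the case
`k = 1` just works, as `387 < 11 / 16 * 564`. A violation with a period below 864 would lie in the
image of four consecutive letters. In a `7/5⁺`-free word any three consecutive letters are distinct,
and so one computation with the image of a single word (`noMatches_deanMorphism`) excludes it.

*A `7/5⁺`-free word over four letters* (`le_of_matches_pansiotWord`). In a word in which any three
consecutive letters are distinct, a bit tells whether the next letter is the one that leaves the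
window of three letters or the missing fourth one (Pansiot's code). The word taken here has as its code
the fixed point of a 78-uniform binary morphism. This morphism is chosen such that the image of
a bit permutes the windows in the same way as the bit (`foldl_pansiotMorphism`), so that the window at
position `78 m` is the window at position `m` (`pansiotState_mul`). A long match has, by another
marker, a period `78 k`, and dividing by 78 gives a match of period `k` that violates the bound as well
(`exists_matches_of_matches_pansiotWord`). Short periods are excluded by computation, as up to
a renaming of the letters every short factor occurs in a short prefix of the word.

*The upper bound* (`not_isGoodBits`). The letters of a reduced square-free word alternate in parity,
so that the word is given by the bits `b i` that tell `0` from `2` and `1` from `3`. The conditions on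
the word become conditions on matches of even period and on windows of length 11 at positions of the
same parity; they are invariant under shifts and under inversion of the bits at all even or at all odd
positions. A depth-first search shows that no word of length 129 satisfies them. It becomes short by
bounding first the lengths of the words that begin with four particular windows (`Excludes`): another
branch is cut as soon as it meets one of these windows early enough.

The computations are run by the kernel on natural numbers that encode words or sets of windows.
-/

/-! ### Factors, periods and matches -/

/-- The letters of `w` at the `l` positions from `i` on agree with those at distance `p`. -/
def Matches {α : Type*} (w : ℕ → α) (i p l : ℕ) : Prop :=
  ∀ t < l, w (i + t) = w (i + t + p)

theorem Matches.mono {α : Type*} {w : ℕ → α} {i p l l' : ℕ} (h : Matches w i p l) (hl : l' ≤ l) :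
    Matches w i p l' := fun t ht => h t (by omega)

@[simp] theorem length_prefixOf {α : Type*} (w : ℕ → α) (n : ℕ) : (prefixOf w n).length = n := by
  simp [prefixOf]

theorem getElem?_prefixOf {α : Type*} (w : ℕ → α) {n i : ℕ} (h : i < n) :
    (prefixOf w n)[i]? = some (w i) := by
  simp [prefixOf, h]

/-- A finite word of which `v` is a continuation is the prefix of `v` of the same length. -/
theorem eq_prefixOf {α : Type*} {w : List α} {v : ℕ → α} {n : ℕ} (hn : w.length = n)
    (h : ∀ i < n, w[i]? = some (v i)) : w = prefixOf v n := by
  apply List.ext_getElem?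
  intro i
  by_cases hi : i < n
  · rw [h i hi, getElem?_prefixOf v hi]
  · rw [List.getElem?_eq_none (by omega), List.getElem?_eq_none (by simp; omega)]

theorem mem_wordFactors_prefixOf {α : Type*} {v : ℕ → α} {n : ℕ} {f : List α} :
    f ∈ wordFactors (prefixOf v n) ↔
      ∃ i, i + f.length ≤ n ∧ f = prefixOf (fun j => v (i + j)) f.length := by
  constructor
  · intro h
    obtain ⟨i, hi, hf⟩ := List.infix_iff_getElem?.1 h
    rw [length_prefixOf] at hi
    refine ⟨i, by omega, eq_prefixOf rfl fun j hj => ?_⟩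
    rw [List.getElem?_eq_getElem hj, ← hf j hj, getElem?_prefixOf v (by omega), Nat.add_comm]
  · rintro ⟨i, hi, hf⟩
    refine List.infix_iff_getElem?.2 ⟨i, by simpa [Nat.add_comm] using hi, fun j hj => ?_⟩
    rw [getElem?_prefixOf v (by omega), ← List.getElem?_eq_getElem hj]
    conv_rhs => rw [hf]
    rw [getElem?_prefixOf _ hj, Nat.add_comm]

theorem mem_infFactors_iff {α : Type*} {v : ℕ → α} {f : List α} :
    f ∈ infFactors v ↔ ∃ n, f ∈ wordFactors (prefixOf v n) := by
  constructor
  · rintro ⟨i, n, rfl⟩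
    exact ⟨i + n, mem_wordFactors_prefixOf.2 ⟨i, by simp, by simp⟩⟩
  · rintro ⟨n, h⟩
    obtain ⟨i, -, hf⟩ := mem_wordFactors_prefixOf.1 h
    exact ⟨i, _, hf⟩

theorem prefixOf_prefix {α : Type*} (v : ℕ → α) {m n : ℕ} (h : m ≤ n) :
    prefixOf v m <+: prefixOf v n := by
  refine List.prefix_iff_getElem?.2 fun i hi => ?_
  have hi' : i < m := by simpa using hi
  rw [getElem?_prefixOf v (by omega), ← List.getElem?_eq_getElem hi, getElem?_prefixOf v hi']

theorem wordFactors_prefixOf_mono {α : Type*} (v : ℕ → α) {m n : ℕ} (h : m ≤ n) :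
    wordFactors (prefixOf v m) ⊆ wordFactors (prefixOf v n) :=
  fun _ hf => List.IsInfix.trans hf (prefixOf_prefix v h).isInfix

theorem wordFactors_prefixOf_subset {α : Type*} (v : ℕ → α) (n : ℕ) :
    wordFactors (prefixOf v n) ⊆ infFactors v :=
  fun _ hf => mem_infFactors_iff.2 ⟨n, hf⟩

theorem hasPeriod_prefixOf_iff {α : Type*} {v : ℕ → α} {p l : ℕ} :
    HasPeriod (prefixOf v (p + l)) p ↔ Matches v 0 p l := by
  unfold HasPeriod Matches
  simp only [length_prefixOf]
  constructor
  · intro h t ht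
    have := h t (by omega)
    rw [getElem?_prefixOf v (by omega), getElem?_prefixOf v (by omega)] at this
    simpa using this
  · intro h t ht
    rw [getElem?_prefixOf v (by omega), getElem?_prefixOf v (by omega)]
    simpa using h t (by omega)

theorem matches_shift {α : Type*} {v : ℕ → α} {i p l : ℕ} :
    Matches (fun j => v (i + j)) 0 p l ↔ Matches v i p l := by
  simp [Matches, Nat.add_assoc]

/-- The factor of length `p + l` at position `i` of a prefix, with period `p`. -/
theorem exists_factor_of_matches {α : Type*} {v : ℕ → α} {n i p l : ℕ} (hn : i + p + l ≤ n)
    (h : Matches v i p l) :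
    ∃ f ∈ wordFactors (prefixOf v n), f.length = p + l ∧ HasPeriod f p :=
  ⟨prefixOf (fun j => v (i + j)) (p + l),
    mem_wordFactors_prefixOf.2 ⟨i, by simp; omega, by simp⟩, by simp,
    hasPeriod_prefixOf_iff.2 (matches_shift.2 h)⟩

theorem isPlusFreeWord_prefixOf_iff {α : Type*} {v : ℕ → α} {n : ℕ} {β : ℚ} (hβ : 1 ≤ β) :
    IsPlusFreeWord β (wordFactors (prefixOf v n)) ↔
      ∀ i p l, 0 < p → i + p + l ≤ n → Matches v i p l → ((p + l : ℕ) : ℚ) / p ≤ β := by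
  constructor
  · intro h i p l hp hn hm
    obtain ⟨f, hf, hl, hper⟩ := exists_factor_of_matches hn hm
    rw [← hl]
    exact h f hf p hp hper
  · intro h f hf p hp hper
    obtain ⟨i, hi, hf'⟩ := mem_wordFactors_prefixOf.1 hf
    have hp' : (0 : ℚ) < p := by exact_mod_cast hp
    rcases le_or_gt p f.length with hpl | hpl
    · obtain ⟨l, hl⟩ := Nat.exists_eq_add_of_le hpl
      rw [hl]
      refine h i p l hp (by omega) ?_
      rw [hf', hl] at hper
      exact matches_shift.1 (hasPeriod_prefixOf_iff.1 hper)
    · refine le_trans ?_ hβ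
      rw [div_le_one hp']
      exact_mod_cast hpl.le

theorem isPlusFreeWord_mono {α : Type*} {β : ℚ} {L L' : Set (List α)} (h : L' ⊆ L)
    (hL : IsPlusFreeWord β L) : IsPlusFreeWord β L' := fun f hf => hL f (h hf)

theorem isPlusFreeWord_infFactors {α : Type*} {β : ℚ} {v : ℕ → α}
    (h : ∀ n, IsPlusFreeWord β (wordFactors (prefixOf v n))) : IsPlusFreeWord β (infFactors v) := by
  intro f hf
  obtain ⟨n, hn⟩ := mem_infFactors_iff.1 hf
  exact h n f hn

theorem isDeanWord_infFactors {v : ℕ → Fin 4}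
    (h : ∀ n, IsDeanWord (wordFactors (prefixOf v n))) : IsDeanWord (infFactors v) := by
  refine ⟨⟨?_, ?_, ?_, ?_⟩, fun x hx hf => ?_⟩
  · intro hf
    obtain ⟨n, hn⟩ := mem_infFactors_iff.1 hf
    exact (h n).1.1 hn
  · intro hf
    obtain ⟨n, hn⟩ := mem_infFactors_iff.1 hf
    exact (h n).1.2.1 hn
  · intro hf
    obtain ⟨n, hn⟩ := mem_infFactors_iff.1 hf
    exact (h n).1.2.2.1 hn
  · intro hf
    obtain ⟨n, hn⟩ := mem_infFactors_iff.1 hf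
    exact (h n).1.2.2.2 hn
  · obtain ⟨n, hn⟩ := mem_infFactors_iff.1 hf
    exact (h n).2 x hx hn

theorem isDirectedWord_infFactors {α : Type*} {d : ℕ} {v : ℕ → α}
    (h : ∀ n, IsDirectedWord d (wordFactors (prefixOf v n))) : IsDirectedWord d (infFactors v) := by
  intro f hf hd hr
  obtain ⟨n, hn⟩ := mem_infFactors_iff.1 hf
  obtain ⟨m, hm⟩ := mem_infFactors_iff.1 hr
  exact h (max n m) f (wordFactors_prefixOf_mono v (le_max_left n m) hn) hd
    (wordFactors_prefixOf_mono v (le_max_right n m) hm)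

/-- A square is a repetition of exponent `2`. -/
theorem IsPlusFreeWord.isSquareFreeWord {α : Type*} {β : ℚ} {L : Set (List α)} (hβ : β < 2)
    (h : IsPlusFreeWord β L) : IsSquareFreeWord L := by
  intro v hv hL
  have hpos : 0 < v.length := List.length_pos_iff.2 hv
  have := h _ hL v.length hpos (by
    intro i hi
    rw [List.length_append] at hi
    rw [List.getElem?_append_left (by omega), List.getElem?_append_right (by omega)]
    simp)
  have hpos' : (0 : ℚ) < v.length := by exact_mod_cast hpos
  rw [div_le_iff₀ hpos', List.length_append] at this
  push_cast at this
  nlinarith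

/-- The image of a prefix under a `q`-uniform morphism is a prefix of the image. -/
theorem flatMap_prefixOf {α β : Type*} {h : α → List β} {q : ℕ} (hq : ∀ a, (h a).length = q)
    {u : ℕ → α} {v : ℕ → β} (hv : ∀ n, ∀ r < q, (h (u n))[r]? = some (v (q * n + r))) (n : ℕ) :
    (prefixOf u n).flatMap h = prefixOf v (q * n) := by
  induction n with
  | zero => simp [prefixOf]
  | succ n ih =>
    have hu : prefixOf u (n + 1) = prefixOf u n ++ [u n] := by
      simp [prefixOf, List.range_succ]
    rw [hu, List.flatMap_append, ih]
    refine eq_prefixOf (by simp [hq, Nat.mul_succ]) fun i hi => ?_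
    rw [Nat.mul_succ] at hi
    rcases lt_or_ge i (q * n) with h1 | h1
    · rw [List.getElem?_append_left (by simpa using h1), getElem?_prefixOf v h1]
    · rw [List.getElem?_append_right (by simpa using h1)]
      obtain ⟨r, rfl⟩ := Nat.exists_eq_add_of_le h1
      simpa using hv n r (by omega)

/-! ### Searching long matches with bit operations -/

/-- `evalThen n f` is `f n`, by recursion on `n`, so that the kernel computes the value of `n`
before it enters `f`. -/
def evalThen {α : Type} (n : ℕ) (f : ℕ → α) : α :=
  Nat.rec (f 0) (fun k _ => f (Nat.succ k)) n

theorem evalThen_eq {α : Type} (n : ℕ) (f : ℕ → α) : evalThen n f = f n := by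
  cases n <;> rfl

/-- The number whose digits in base `2 ^ q`, the least significant one first, are listed. -/
def concatBlocks (q : ℕ) (l : List ℕ) : ℕ :=
  l.foldr (fun a n => a + 2 ^ q * n) 0

theorem testBit_concatBlocks {q : ℕ} {l : List ℕ} (hl : ∀ a ∈ l, a < 2 ^ q) {j a r : ℕ}
    (hj : l[j]? = some a) (hr : r < q) :
    (concatBlocks q l).testBit (q * j + r) = a.testBit r := by
  induction l generalizing j with
  | nil => simp at hj
  | cons b l ih =>
    have hb : b < 2 ^ q := hl b (by simp)
    have hc : concatBlocks q (b :: l) = 2 ^ q * concatBlocks q l + b := by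
      simp [concatBlocks, Nat.add_comm]
    rw [hc, Nat.testBit_two_pow_mul_add _ hb]
    cases j with
    | zero =>
      have : b = a := by simpa using hj
      simp [hr, this]
    | succ j =>
      have h1 : ¬ q * (j + 1) + r < q := by rw [Nat.mul_succ]; omega
      have h2 : q * (j + 1) + r - q = q * j + r := by rw [Nat.mul_succ]; omega
      rw [if_neg h1, h2]
      exact ih (fun x hx => hl x (by simp [hx])) (by simpa using hj)

/-- The number with the given bits, the least significant one first. -/
def ofBitList (l : List Bool) : ℕ := concatBlocks 1 (l.map Bool.toNat)

theorem testBit_ofBitList {l : List Bool} {j : ℕ} {b : Bool} (hj : l[j]? = some b) :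
    (ofBitList l).testBit j = b := by
  have := testBit_concatBlocks (q := 1) (l := l.map Bool.toNat) (j := j) (a := b.toNat) (r := 0)
    (by simp only [List.mem_map]; rintro a ⟨b, -, rfl⟩; cases b <;> simp) (by simp [hj]) (by simp)
  rw [Nat.one_mul, Nat.add_zero] at this
  rw [ofBitList, this]
  cases b <;> rfl

theorem ofBitList_lt (l : List Bool) : ofBitList l < 2 ^ l.length := by
  induction l with
  | nil => simp [ofBitList, concatBlocks]
  | cons b l ih =>
    have : ofBitList (b :: l) = b.toNat + 2 * ofBitList l := by simp [ofBitList, concatBlocks]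
    have hb : b.toNat < 2 := by cases b <;> simp
    rw [this, List.length_cons, Nat.pow_succ]
    omega

/-- The bits of the result tell whether one of the next `k` bits of a number is set: if bit `i` of
`D` says that one of the `d` bits of the number from `i` on is set, then bit `i` of
`orWindow fuel k d D` says so for `k` bits. The window is doubled while `2 * d ≤ k`; the `fuel` bounds
the number of doublings, and with too little fuel fewer bits are set. -/
def orWindow (fuel k : ℕ) : ℕ → ℕ → ℕ :=
  Nat.rec (fun d D => Nat.lor D (Nat.shiftRight D (Nat.sub k d)))
    (fun _ ih d D =>
      cond (Nat.ble (Nat.mul 2 d) k)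
        (evalThen (Nat.lor D (Nat.shiftRight D d)) fun D => evalThen (Nat.mul 2 d) fun d => ih d D)
        (Nat.lor D (Nat.shiftRight D (Nat.sub k d)))) fuel

/-- Only this direction holds for all values of `fuel`. -/
theorem exists_testBit_of_orWindow {M k : ℕ} (fuel : ℕ) {d D : ℕ} (hd : d ≤ k)
    (hD : ∀ i, D.testBit i = true → ∃ t < d, M.testBit (i + t) = true) {i : ℕ}
    (hi : (orWindow fuel k d D).testBit i = true) : ∃ t < k, M.testBit (i + t) = true := by
  have last : ∀ d D, d ≤ k → (∀ i, D.testBit i = true → ∃ t < d, M.testBit (i + t) = true) →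
      (D ||| D >>> (k - d)).testBit i = true → ∃ t < k, M.testBit (i + t) = true := by
    intro d D hd hD hi
    rw [Nat.testBit_or, Bool.or_eq_true, Nat.testBit_shiftRight] at hi
    rcases hi with hi | hi
    · obtain ⟨t, ht, h⟩ := hD _ hi
      exact ⟨t, by omega, h⟩
    · obtain ⟨t, ht, h⟩ := hD _ hi
      exact ⟨k - d + t, by omega, by rw [← h]; congr 1; omega⟩
  induction fuel generalizing d D with
  | zero => exact last d D hd hD hi
  | succ fuel ih =>
    have hdef : orWindow (fuel + 1) k d D = cond (Nat.ble (2 * d) k)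
        (evalThen (D ||| D >>> d) fun D => evalThen (2 * d) fun d => orWindow fuel k d D)
        (D ||| D >>> (k - d)) := rfl
    rw [hdef] at hi
    simp only [evalThen_eq] at hi
    cases hb : Nat.ble (2 * d) k with
    | false =>
      rw [hb] at hi
      exact last d D hd hD hi
    | true =>
      rw [hb] at hi
      refine ih (Nat.le_of_ble_eq_true hb) (fun i hi => ?_) hi
      rw [Nat.testBit_or, Bool.or_eq_true, Nat.testBit_shiftRight] at hi
      rcases hi with hi | hi
      · obtain ⟨t, ht, h⟩ := hD _ hi
        exact ⟨t, by omega, h⟩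
      · obtain ⟨t, ht, h⟩ := hD _ hi
        exact ⟨d + t, by omega, by rw [← h]; congr 1; omega⟩

/-- For a word over four letters with low bits `A` and high bits `B`: at each of the positions below
`m`, one of the next `k` letters differs from the letter at distance `p`. -/
def noMatch (A B m p k : ℕ) : Bool :=
  evalThen (Nat.lor (Nat.xor A (Nat.shiftRight A p)) (Nat.xor B (Nat.shiftRight B p))) fun M =>
    Nat.beq (Nat.mod (orWindow 10 k 1 M) (Nat.pow 2 m)) (Nat.pred (Nat.pow 2 m))

theorem exists_ne_of_noMatch {A B m p k : ℕ} (hk : 1 ≤ k) (h : noMatch A B m p k = true) {i : ℕ}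
    (hi : i < m) : ∃ t < k, A.testBit (i + t) ≠ A.testBit (i + t + p) ∨
      B.testBit (i + t) ≠ B.testBit (i + t + p) := by
  rw [noMatch, evalThen_eq] at h
  have h' := Nat.eq_of_beq_eq_true h
  set M := Nat.lor (Nat.xor A (Nat.shiftRight A p)) (Nat.xor B (Nat.shiftRight B p)) with hM
  have hbit : (orWindow 10 k 1 M).testBit i = true := by
    have h1 : (orWindow 10 k 1 M % 2 ^ m).testBit i = true := by
      change orWindow 10 k 1 M % 2 ^ m = 2 ^ m - 1 at h'
      rw [h', Nat.testBit_two_pow_sub_one]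
      simpa using hi
    rw [Nat.testBit_mod_two_pow] at h1
    simp only [Bool.and_eq_true] at h1
    exact h1.2
  obtain ⟨t, ht, hb⟩ := exists_testBit_of_orWindow (M := M) 10 hk
    (fun i hi => ⟨0, by simp, by simpa using hi⟩) hbit
  refine ⟨t, ht, ?_⟩
  have hM' : M = (A ^^^ A >>> p) ||| (B ^^^ B >>> p) := rfl
  rw [hM'] at hb
  simp only [Nat.testBit_or, Nat.testBit_xor, Nat.testBit_shiftRight, Bool.or_eq_true,
    bne_iff_ne, Nat.add_comm p] at hb
  exact hb

/-- `noMatch` for all periods `p` with `0 < p < P`, with the least length `k` for which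
`a * p < b * k`. -/
def noMatches (a b A B m P : ℕ) : Bool :=
  Nat.rec true (fun p ih => cond ih (evalThen (Nat.succ p) fun p =>
    evalThen (Nat.succ (Nat.div (Nat.mul a p) b)) fun k => noMatch A B m p k) false) (Nat.pred P)

theorem noMatch_of_noMatches {a b A B m P : ℕ} (h : noMatches a b A B m P = true) {p : ℕ}
    (hp : 0 < p) (hP : p < P) : noMatch A B m p (a * p / b + 1) = true := by
  obtain ⟨P, rfl⟩ : ∃ Q, P = Q + 1 := ⟨P - 1, by omega⟩
  induction P with
  | zero => omega
  | succ P ih =>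
    have hdef : noMatches a b A B m (P + 1 + 1) = cond (noMatches a b A B m (P + 1))
        (evalThen (P + 1) fun p => evalThen (a * p / b + 1) fun k => noMatch A B m p k) false := rfl
    rw [hdef] at h
    simp only [evalThen_eq, Bool.cond_false_right, Bool.and_eq_true] at h
    rcases Nat.lt_succ_iff_lt_or_eq.1 hP with h1 | rfl
    · exact ih h.1 h1
    · exact h.2

/-! ### Finite facts on the morphism -/

/-- The parity of a letter. -/
def lowBit (a : Fin 4) : Bool := a.val.testBit 0

/-- The bit that tells `0` from `2` and `1` from `3`. -/
def highBit (a : Fin 4) : Bool := a.val.testBit 1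

theorem eq_of_bits_eq : ∀ {a b : Fin 4}, lowBit a = lowBit b → highBit a = highBit b → a = b := by
  decide

theorem length_deanMorphism : ∀ a, (deanMorphism a).length = 564 := by
  decide +kernel

/-- The first 100 letters of the image of each letter. -/
def deanPrefix : List (Fin 4) := (deanMorphism 0).take 100

theorem take_deanMorphism : ∀ a, (deanMorphism a).take 100 = deanPrefix := by
  decide +kernel

/-- The common prefixes of the images of distinct letters have length at most 301. -/
theorem take_deanMorphism_ne :
    ∀ a b, a ≠ b → (deanMorphism a).take 302 ≠ (deanMorphism b).take 302 := by
  decide +kernel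

/-- The common suffixes of the images of distinct letters have length at most 86. -/
theorem drop_deanMorphism_ne :
    ∀ a b, a ≠ b → (deanMorphism a).drop 477 ≠ (deanMorphism b).drop 477 := by
  decide +kernel

/-- A word that occurs in the image of each letter at position 55, and at no other position of an
image of a word. -/
def deanMarker : List (Fin 4) := digitWord 31 3210301232103230121032123010321

theorem marker_prefix_drop : ∀ a, deanMarker <+: (deanMorphism a).drop 55 := by
  decide +kernel

theorem not_marker_prefix_drop : ∀ a, ∀ x ∈ ((deanMorphism a ++ deanPrefix).tails.take 564).zipIdx,
    x.2 ≠ 55 → ¬ deanMarker <+: x.1 := by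
  decide +kernel

/-- The decimal numerals of the factors of length 10 of the images of words. -/
def deanFactors : List ℕ :=
  [103210123, 103230121, 121030123, 121032123, 123032103, 123032123, 123210123, 123210323,
   301232101, 301232103, 321012303, 321030123, 321230103, 323012103, 1012303210, 1012303212,
   1030123210, 1032101230, 1032123010, 1032301210, 1210301232, 1210321230, 1230103210, 1230103230,
   1230321030, 1230321230, 1232101230, 1232103230, 2101230321, 2103012321, 2103212301, 2103230121,
   2123010321, 2123010323, 2301032101, 2301032301, 2301210301, 2301210321, 2303210301, 2303212301,
   2321012303, 2321032301, 3010321012, 3010323012, 3012103012, 3012103212, 3012321012, 3012321032,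
   3032103012, 3032123010, 3210123032, 3210301232, 3210323012, 3212301032, 3230121030, 3230121032]

/-- The number with the given decimal digits. -/
def numeral (f : List (Fin 4)) : ℕ := f.foldl (fun n a => evalThen (Nat.add (Nat.mul 10 n) a.val) id) 0

/-- Whether the word is one of `deanFactors`. -/
def isDeanFactor (f : List (Fin 4)) : Bool :=
  evalThen (numeral f) fun n => deanFactors.any fun m => Nat.beq m n

/-- Windows that start in the image of a letter end in the common prefix of all images. The list
`deanFactors` separates the factors of length 10 from their reverses. -/
theorem isDeanFactor_window : ∀ a, (((deanMorphism a ++ deanPrefix).tails.take 564).all fun f =>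
    isDeanFactor (f.take 10) && !isDeanFactor (f.take 10).reverse) = true := by
  decide +kernel

theorem adjacent_window : ∀ a, ∀ f ∈ (deanMorphism a ++ deanPrefix).tails.take 564,
    f.take 2 ∉ [[0, 2], [2, 0], [1, 3], [3, 1]] := by
  decide +kernel

/-- A word with all 48 words of length 4 as factors in which any three consecutive letters are
distinct, each of them once. -/
def deBruijnWord : List (Fin 4) :=
  [0, 1, 2, 3, 1, 2, 3, 0, 2, 3, 1, 0, 3, 2, 1, 3, 2, 1, 0, 3, 1, 2, 0, 3, 2, 0, 3, 1, 0, 2, 3, 0, 1,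
   3, 2, 0, 1, 3, 0, 2, 1, 0, 2, 1, 3, 0, 1, 2, 0, 1, 2]

theorem exists_deBruijnWord : ∀ a b c d : Fin 4, a ≠ b → a ≠ c → b ≠ c → b ≠ d → c ≠ d →
    ∃ j < 48, (deBruijnWord.drop j).take 4 = [a, b, c, d] := by
  decide +kernel

/-- The number whose bits are the low bits of the image of a letter. -/
def lowPlane (a : Fin 4) : ℕ := ofBitList ((deanMorphism a).map lowBit)

/-- The number whose bits are the high bits of the image of a letter. -/
def highPlane (a : Fin 4) : ℕ := ofBitList ((deanMorphism a).map highBit)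

/-- No match of period below 864 that violates the bound begins in the image of one of the first 48
letters of `deBruijnWord`. Such a match has, shortened, a length of at most 594, so that it ends within
the images of four consecutive letters. -/
theorem noMatches_deanMorphism :
    (evalThen (concatBlocks 564 (deBruijnWord.map lowPlane)) fun A =>
      evalThen (concatBlocks 564 (deBruijnWord.map highPlane)) fun B =>
        noMatches 11 16 A B (48 * 564) 864) = true := by
  decide +kernel

/-! ### Images under the morphism -/

/-- The image of an infinite word: letter `n` lies in the block of letter `n / 564`. -/
def deanImage (u : ℕ → Fin 4) (n : ℕ) : Fin 4 :=
  (deanMorphism (u (n / 564))).getD (n % 564) 0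

theorem getElem?_deanMorphism (a : Fin 4) {r : ℕ} (hr : r < 564) :
    (deanMorphism a)[r]? = some ((deanMorphism a).getD r 0) := by
  rw [List.getD_eq_getElem?_getD, List.getElem?_eq_getElem (by rw [length_deanMorphism]; exact hr)]
  rfl

theorem deanImage_add (u : ℕ → Fin 4) (n : ℕ) {r : ℕ} (hr : r < 564) :
    deanImage u (564 * n + r) = (deanMorphism (u n)).getD r 0 := by
  have h1 : (564 * n + r) / 564 = n := by omega
  have h2 : (564 * n + r) % 564 = r := by omega
  rw [deanImage, h1, h2]

theorem getElem?_deanMorphism_eq (u : ℕ → Fin 4) (n r : ℕ) (hr : r < 564) :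
    (deanMorphism (u n))[r]? = some (deanImage u (564 * n + r)) := by
  rw [getElem?_deanMorphism _ hr, deanImage_add u n hr]

theorem wordImage_prefixOf (u : ℕ → Fin 4) (n : ℕ) :
    wordImage deanMorphism (prefixOf u n) = prefixOf (deanImage u) (564 * n) :=
  flatMap_prefixOf length_deanMorphism (getElem?_deanMorphism_eq u) n

theorem infImage_deanMorphism (u : ℕ → Fin 4) : infImage deanMorphism u = deanImage u := by
  funext n
  rw [infImage, wordImage_prefixOf, List.getD_eq_getElem?_getD, getElem?_prefixOf _ (by omega)]
  rfl

theorem deanImage_congr {u v : ℕ → Fin 4} {n : ℕ} (h : ∀ i < n, u i = v i) {m : ℕ}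
    (hm : m < 564 * n) : deanImage u m = deanImage v m := by
  rw [deanImage, deanImage, h (m / 564) (by omega)]

/-- Any three consecutive letters are distinct. -/
def IsLocallyDistinct (u : ℕ → Fin 4) : Prop :=
  ∀ j, u j ≠ u (j + 1) ∧ u j ≠ u (j + 2)

/-- The continuation of an image may be taken to be the common prefix of all images. -/
theorem getElem?_append_deanPrefix (u : ℕ → Fin 4) (n : ℕ) {x : ℕ} (hx : x < 664) :
    (deanMorphism (u n) ++ deanPrefix)[x]? = some (deanImage u (564 * n + x)) := by
  rcases lt_or_ge x 564 with h | h
  · rw [List.getElem?_append_left (by rw [length_deanMorphism]; exact h),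
      getElem?_deanMorphism_eq u n x h]
  · rw [List.getElem?_append_right (by rw [length_deanMorphism]; exact h), length_deanMorphism,
      ← take_deanMorphism (u (n + 1)), List.getElem?_take_of_lt (by omega),
      getElem?_deanMorphism_eq u (n + 1) _ (by omega),
      show 564 * (n + 1) + (x - 564) = 564 * n + x by omega]

/-- The tail of the continued image of a letter that starts at position `i` of the image of `u`. -/
def windowAt (u : ℕ → Fin 4) (i : ℕ) : List (Fin 4) :=
  (deanMorphism (u (i / 564)) ++ deanPrefix).drop (i % 564)

theorem getElem?_windowAt (u : ℕ → Fin 4) (i : ℕ) {t : ℕ} (ht : t < 100) :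
    (windowAt u i)[t]? = some (deanImage u (i + t)) := by
  rw [windowAt, List.getElem?_drop, getElem?_append_deanPrefix u _ (by omega)]
  congr 2
  omega

theorem length_append_deanPrefix (a : Fin 4) : (deanMorphism a ++ deanPrefix).length = 664 := by
  rw [List.length_append, length_deanMorphism, deanPrefix, List.length_take, length_deanMorphism]
  rfl

theorem getElem?_tails {α : Type*} (l : List α) {i : ℕ} (hi : i ≤ l.length) :
    l.tails[i]? = some (l.drop i) := by
  rw [List.getElem?_eq_getElem (by simp; omega)]
  simp

theorem getElem?_tails_windowAt (u : ℕ → Fin 4) (i : ℕ) :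
    ((deanMorphism (u (i / 564)) ++ deanPrefix).tails.take 564)[i % 564]? = some (windowAt u i) := by
  rw [List.getElem?_take_of_lt (by omega),
    getElem?_tails _ (by rw [length_append_deanPrefix]; omega), windowAt]

theorem windowAt_mem_tails (u : ℕ → Fin 4) (i : ℕ) :
    windowAt u i ∈ (deanMorphism (u (i / 564)) ++ deanPrefix).tails.take 564 :=
  List.mem_of_getElem? (getElem?_tails_windowAt u i)

theorem take_windowAt (u : ℕ → Fin 4) (i : ℕ) {n : ℕ} (hn : n ≤ 100) :
    (windowAt u i).take n = prefixOf (fun j => deanImage u (i + j)) n := by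
  refine eq_prefixOf ?_ fun t ht => ?_
  · rw [List.length_take, windowAt, List.length_drop, length_append_deanPrefix]
    omega
  · rw [List.getElem?_take_of_lt ht, getElem?_windowAt u i (by omega)]

/-! ### Short factors of images -/

theorem isReducedWord_deanImage (u : ℕ → Fin 4) (n : ℕ) :
    IsReducedWord (wordFactors (prefixOf (deanImage u) n)) := by
  have key : ∀ f ∈ [[0, 2], [2, 0], [1, 3], [(3 : Fin 4), 1]],
      f ∉ wordFactors (prefixOf (deanImage u) n) := by
    intro f hf hw
    obtain ⟨i, -, hi⟩ := mem_wordFactors_prefixOf.1 hw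
    have hl : f.length = 2 := by
      clear hw hi
      revert f
      decide
    rw [hl, ← take_windowAt u i (by omega)] at hi
    exact adjacent_window _ _ (windowAt_mem_tails u i) (hi ▸ hf)
  exact ⟨key _ (by simp), key _ (by simp), key _ (by simp), key _ (by simp)⟩

theorem isDirectedWord_deanImage (u : ℕ → Fin 4) (n : ℕ) :
    IsDirectedWord 10 (wordFactors (prefixOf (deanImage u) n)) := by
  have key : ∀ f ∈ wordFactors (prefixOf (deanImage u) n), f.length = 10 →
      isDeanFactor f = true ∧ isDeanFactor f.reverse = false := by
    intro f hf hl
    obtain ⟨i, -, hi⟩ := mem_wordFactors_prefixOf.1 hf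
    rw [hl, ← take_windowAt u i (by omega)] at hi
    have := List.all_eq_true.1 (isDeanFactor_window _) _ (windowAt_mem_tails u i)
    rw [← hi] at this
    simpa using this
  intro f hf hl hr
  have h1 := (key f hf hl).2
  have h2 := (key _ hr (by simpa using hl)).1
  rw [h1] at h2
  exact Bool.false_ne_true h2

theorem IsLocallyDistinct.exists_deBruijnWord {u : ℕ → Fin 4} (hu : IsLocallyDistinct u) (m : ℕ) :
    ∃ j < 48, ∀ t < 4, deBruijnWord[j + t]? = some (u (m + t)) := by
  obtain ⟨j, hj, h⟩ := _root_.exists_deBruijnWord (u m) (u (m + 1)) (u (m + 2)) (u (m + 3))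
    (hu m).1 (hu m).2 (hu (m + 1)).1 (hu (m + 1)).2 (hu (m + 2)).1
  refine ⟨j, hj, fun t ht => ?_⟩
  have : ((deBruijnWord.drop j).take 4)[t]? = deBruijnWord[j + t]? := by
    rw [List.getElem?_take_of_lt ht, List.getElem?_drop]
  rw [← this, h]
  interval_cases t <;> rfl

theorem testBit_concatBlocks_plane {bit : Fin 4 → Bool} {l : List (Fin 4)} {j r : ℕ} {a : Fin 4}
    (hj : l[j]? = some a) (hr : r < 564) :
    (concatBlocks 564 (l.map fun a => ofBitList ((deanMorphism a).map bit))).testBit (564 * j + r) =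
      bit ((deanMorphism a).getD r 0) := by
  rw [testBit_concatBlocks (a := ofBitList ((deanMorphism a).map bit)) _ (by simp [hj]) hr]
  · exact testBit_ofBitList (by rw [List.getElem?_map, getElem?_deanMorphism a hr]; rfl)
  · simp only [List.mem_map]
    rintro x ⟨a, -, rfl⟩
    have := ofBitList_lt ((deanMorphism a).map bit)
    rwa [List.length_map, length_deanMorphism] at this

/-- Short periods: a match violating the bound lies in the image of four consecutive letters. -/
theorem not_matches_deanImage_of_lt {u : ℕ → Fin 4} (hu : IsLocallyDistinct u) {i p : ℕ}
    (hp : 0 < p) (hp' : p < 864) : ¬ Matches (deanImage u) i p (11 * p / 16 + 1) := by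
  intro hm
  -- the letters `i / 564`, ..., `i / 564 + 3` are found at position `j` of `deBruijnWord`
  obtain ⟨j, hj, hw⟩ := hu.exists_deBruijnWord (i / 564)
  have hno := noMatches_deanMorphism
  simp only [evalThen_eq] at hno
  obtain ⟨t, ht, hne⟩ := exists_ne_of_noMatch (by omega) (noMatch_of_noMatches hno hp hp')
    (i := 564 * j + i % 564) (by omega)
  have bits : ∀ (bit : Fin 4 → Bool) (x : ℕ), x < 2256 →
      (concatBlocks 564 (deBruijnWord.map fun a => ofBitList ((deanMorphism a).map bit))).testBit
        (564 * j + x) = bit (deanImage u (564 * (i / 564) + x)) := by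
    intro bit x hx
    have h1 : 564 * j + x = 564 * (j + x / 564) + x % 564 := by omega
    have h2 : 564 * (i / 564) + x = 564 * (i / 564 + x / 564) + x % 564 := by omega
    rw [h1, h2, testBit_concatBlocks_plane (hw (x / 564) (by omega)) (by omega),
      deanImage_add u _ (by omega)]
  have eq : deanImage u (564 * (i / 564) + (i % 564 + t)) =
      deanImage u (564 * (i / 564) + (i % 564 + t + p)) := by
    have := hm t ht
    convert this using 2 <;> omega
  have hlow := bits lowBit (i % 564 + t) (by omega)
  have hlow' := bits lowBit (i % 564 + t + p) (by omega)
  have hhigh := bits highBit (i % 564 + t) (by omega)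
  have hhigh' := bits highBit (i % 564 + t + p) (by omega)
  rw [eq, ← hlow', ← Nat.add_assoc, ← Nat.add_assoc, ← Nat.add_assoc] at hlow
  rw [eq, ← hhigh', ← Nat.add_assoc, ← Nat.add_assoc, ← Nat.add_assoc] at hhigh
  rcases hne with hne | hne
  · exact hne hlow
  · exact hne hhigh

/-! ### Synchronization -/

theorem length_deanMarker : deanMarker.length = 31 := by decide +kernel

theorem deanImage_marker (u : ℕ → Fin 4) {n : ℕ} (hn : n % 564 = 55) {t : ℕ} (ht : t < 31) :
    deanMarker[t]? = some (deanImage u (n + t)) := by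
  have h := List.prefix_iff_getElem?.1 (marker_prefix_drop (u (n / 564))) t
    (by rw [length_deanMarker]; exact ht)
  rw [← List.getElem?_eq_getElem, List.getElem?_drop,
    getElem?_deanMorphism_eq u _ _ (by omega)] at h
  rw [← h]
  congr 2
  omega

theorem mod_eq_of_deanMarker {u : ℕ → Fin 4} {n : ℕ}
    (h : ∀ t < 31, deanMarker[t]? = some (deanImage u (n + t))) : n % 564 = 55 := by
  by_contra hne
  refine not_marker_prefix_drop (u (n / 564)) (windowAt u n, n % 564) ?_ hne ?_
  · apply List.mem_of_getElem? (i := n % 564)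
    rw [List.getElem?_zipIdx, getElem?_tails_windowAt]
    simp
  · refine List.prefix_iff_getElem?.2 fun t ht => ?_
    have ht' : t < 31 := by rwa [length_deanMarker] at ht
    rw [getElem?_windowAt u n (by omega), ← List.getElem?_eq_getElem ht, h t ht']

/-- Any `594 = 563 + 31` consecutive letters contain an occurrence of the marker. -/
theorem dvd_of_matches_deanImage {u : ℕ → Fin 4} {i p l : ℕ} (hl : 594 ≤ l)
    (h : Matches (deanImage u) i p l) : 564 ∣ p := by
  obtain ⟨s, hs, hs'⟩ : ∃ s ≤ 563, (i + s) % 564 = 55 := by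
    refine ⟨(55 + 564 - i % 564) % 564, by omega, by omega⟩
  have h2 : (i + s + p) % 564 = 55 := by
    refine mod_eq_of_deanMarker (u := u) fun t ht => ?_
    rw [deanImage_marker u hs' ht]
    have := h (s + t) (by omega)
    rw [← Nat.add_assoc] at this
    rw [this]
    congr 2
    omega
  omega

/-- A match at a multiple of the block length that contains the last 87 letters of a block. -/
theorem eq_of_matches_suffix {u : ℕ → Fin 4} {n k : ℕ}
    (h : ∀ r, 477 ≤ r → r < 564 → deanImage u (564 * n + r) = deanImage u (564 * (n + k) + r)) :
    u n = u (n + k) := by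
  by_contra hne
  refine drop_deanMorphism_ne _ _ hne (List.ext_getElem? fun r => ?_)
  rw [List.getElem?_drop, List.getElem?_drop]
  rcases lt_or_ge (477 + r) 564 with hr | hr
  · rw [getElem?_deanMorphism_eq u _ _ hr, getElem?_deanMorphism_eq u _ _ hr, h _ (by omega) hr]
  · rw [List.getElem?_eq_none (by rw [length_deanMorphism]; exact hr),
      List.getElem?_eq_none (by rw [length_deanMorphism]; exact hr)]

/-- A match at a multiple of the block length that contains the first 302 letters of a block. -/
theorem eq_of_matches_prefix {u : ℕ → Fin 4} {n k : ℕ}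
    (h : ∀ r < 302, deanImage u (564 * n + r) = deanImage u (564 * (n + k) + r)) :
    u n = u (n + k) := by
  by_contra hne
  refine take_deanMorphism_ne _ _ hne (List.ext_getElem? fun r => ?_)
  rcases lt_or_ge r 302 with hr | hr
  · rw [List.getElem?_take_of_lt hr, List.getElem?_take_of_lt hr,
      getElem?_deanMorphism_eq u _ _ (by omega), getElem?_deanMorphism_eq u _ _ (by omega), h _ hr]
  · rw [List.getElem?_eq_none (by simp; omega), List.getElem?_eq_none (by simp; omega)]

/-- A long match in the image comes from a match in the preimage: it covers `j` pairs of equal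
letters, and less than 388 letters in the two pairs of partially covered blocks. -/
theorem exists_matches_of_matches_deanImage {u : ℕ → Fin 4} {i k l : ℕ} (hl : 594 ≤ l)
    (h : Matches (deanImage u) i (564 * k) l) :
    ∃ a j, Matches u a k j ∧ l ≤ 564 * j + 387 ∧ i ≤ 564 * a + 563 ∧ 564 * (a + j) ≤ i + l + 563 := by
  have hm : ∀ n, i ≤ n → n < i + l → deanImage u n = deanImage u (n + 564 * k) := by
    intro n h1 h2
    have := h (n - i) (by omega)
    rwa [Nat.add_sub_cancel' h1] at this
  -- the first block of the match is dropped when it is not matched as a whole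
  obtain ⟨a, ha, ha1, ha2⟩ : ∃ a, (a = i / 564 ∨ a = i / 564 + 1) ∧ 564 * a ≤ i + 86 ∧
      (i ≤ 564 * a ∨ u a = u (a + k)) := by
    by_cases hu : u (i / 564) = u (i / 564 + k)
    · exact ⟨i / 564, Or.inl rfl, by omega, Or.inr hu⟩
    · refine ⟨i / 564 + 1, Or.inr rfl, ?_, Or.inl (by omega)⟩
      by_contra hlt
      refine hu (eq_of_matches_suffix fun r hr hr' => ?_)
      rw [hm _ (by omega) (by omega)]
      congr 1
      omega
  -- likewise for the last block; at a block boundary there is no partial block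
  obtain ⟨b, hb, hb1, hb3, hb2⟩ : ∃ b, (b = (i + l) / 564 ∨ b = (i + l) / 564 + 1) ∧
      i + l ≤ 564 * b + 301 ∧ 564 * b ≤ i + l + 563 ∧
      (564 * b ≤ i + l ∨ ∃ c, b = c + 1 ∧ u c = u (c + k)) := by
    by_cases h0 : (i + l) % 564 = 0
    · exact ⟨(i + l) / 564, Or.inl rfl, by omega, by omega, Or.inl (by omega)⟩
    by_cases hu : u ((i + l) / 564) = u ((i + l) / 564 + k)
    · exact ⟨(i + l) / 564 + 1, Or.inr rfl, by omega, by omega, Or.inr ⟨_, rfl, hu⟩⟩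
    · refine ⟨(i + l) / 564, Or.inl rfl, ?_, by omega, Or.inl (by omega)⟩
      by_contra hlt
      refine hu (eq_of_matches_prefix fun r hr => ?_)
      rw [hm _ (by omega) (by omega)]
      congr 1
      omega
  have hab : a ≤ b := by omega
  refine ⟨a, b - a, fun t ht => ?_, by omega, by omega, by omega⟩
  rcases Nat.eq_zero_or_pos t with rfl | ht0
  · rcases ha2 with ha2 | ha2
    · rcases hb2 with hb2 | ⟨c, rfl, hc⟩
      · refine eq_of_matches_prefix fun r hr => ?_
        rw [hm _ (by omega) (by omega)]
        congr 1
        omega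
      · by_cases hca : c = a
        · subst hca; exact hc
        · refine eq_of_matches_prefix fun r hr => ?_
          rw [hm _ (by omega) (by omega)]
          congr 1
          omega
    · exact ha2
  · by_cases hc : ∃ c, b = c + 1 ∧ u c = u (c + k) ∧ c = a + t
    · obtain ⟨c, -, hc, rfl⟩ := hc
      exact hc
    · refine eq_of_matches_prefix fun r hr => ?_
      have : 564 * (a + t) + 564 ≤ i + l := by
        rcases hb2 with hb2 | ⟨c, hbc, hcu⟩
        · omega
        · have : c ≠ a + t := fun e => hc ⟨c, hbc, hcu, e⟩
          omega
      rw [hm _ (by omega) (by omega)]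
      congr 1
      omega

/-- Every finite word in which any three consecutive letters are distinct can be continued. -/
theorem exists_isLocallyDistinct {u : ℕ → Fin 4} {n : ℕ}
    (h1 : ∀ j, j + 1 < n → u j ≠ u (j + 1)) (h2 : ∀ j, j + 2 < n → u j ≠ u (j + 2)) :
    ∃ v, IsLocallyDistinct v ∧ ∀ i < n, v i = u i := by
  have next : ∀ a b : Fin 4, ∃ c, a ≠ c ∧ b ≠ c := by decide
  choose f hf using next
  have start : ∃ a b : Fin 4, a ≠ b ∧ (0 < n → a = u 0) ∧ (1 < n → b = u 1) := by
    by_cases hn : 1 < n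
    · exact ⟨u 0, u 1, h1 0 hn, fun _ => rfl, fun _ => rfl⟩
    · exact ⟨u 0, f (u 0) (u 0), (hf _ _).1, fun _ => rfl, fun h => absurd h hn⟩
  obtain ⟨a, b, hab, ha, hb⟩ := start
  -- the pairs of consecutive letters of the continuation, by recursion
  let w : ℕ → Fin 4 × Fin 4 := fun m =>
    Nat.rec (a, b) (fun m x => (x.2, if m + 2 < n then u (m + 2) else f x.1 x.2)) m
  have w0 : w 0 = (a, b) := rfl
  have ws : ∀ m, w (m + 1) = ((w m).2, if m + 2 < n then u (m + 2) else f (w m).1 (w m).2) :=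
    fun m => rfl
  have hw1 : ∀ m, (w (m + 1)).1 = (w m).2 := fun m => by rw [ws]
  have hwu : ∀ m, (m < n → (w m).1 = u m) ∧ (m + 1 < n → (w m).2 = u (m + 1)) := by
    intro m
    induction m with
    | zero => exact ⟨ha, hb⟩
    | succ m ih =>
      refine ⟨fun h => by rw [hw1]; exact ih.2 h, fun h => ?_⟩
      rw [ws]
      simp [show m + 2 < n from h]
  have hne : ∀ m, (w m).1 ≠ (w m).2 ∧ (w m).1 ≠ (w (m + 1)).2 := by
    intro m
    induction m with
    | zero =>
      refine ⟨hab, ?_⟩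
      rw [ws]
      by_cases h : 0 + 2 < n
      · simp only [h, if_true]
        rw [(hwu 0).1 (by omega)]
        exact h2 0 h
      · simp only [h, if_false]
        exact (hf _ _).1
    | succ m ih =>
      have e1 : (w (m + 1)).1 ≠ (w (m + 1)).2 := by
        by_cases h : m + 2 < n
        · rw [(hwu (m + 1)).1 (by omega), (hwu (m + 1)).2 h]
          exact h1 _ h
        · rw [ws]
          simp only [h, if_false]
          exact (hf _ _).2
      refine ⟨e1, ?_⟩
      rw [ws (m + 1)]
      by_cases h : m + 1 + 2 < n
      · simp only [h, if_true]
        rw [(hwu (m + 1)).1 (by omega)]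
        exact h2 (m + 1) h
      · simp only [h, if_false]
        exact (hf _ _).1
  refine ⟨fun m => (w m).1, fun j => ⟨?_, ?_⟩, fun i hi => (hwu i).1 hi⟩
  · simpa only [hw1] using (hne j).1
  · simpa only [hw1] using (hne j).2

/-! ### Images of `7/5⁺`-free words -/

/-- The image of a `7/5⁺`-free word of length `n` is `27/16⁺`-free, in terms of matches. -/
theorem le_of_matches_deanImage {u : ℕ → Fin 4} {n : ℕ}
    (hu : ∀ i p l, 0 < p → i + p + l ≤ n → Matches u i p l → 5 * l ≤ 2 * p) {i p l : ℕ}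
    (hp : 0 < p) (hn : i + p + l ≤ 564 * n) (hm : Matches (deanImage u) i p l) :
    16 * l ≤ 11 * p := by
  by_contra hlt
  rcases lt_or_ge p 864 with hp' | hp'
  · obtain ⟨v, hv, hvu⟩ := exists_isLocallyDistinct (u := u) (n := n)
      (fun j hj he => by
        have := hu j 1 1 (by omega) (by omega) (fun t ht => by
          obtain rfl : t = 0 := by omega
          exact he)
        omega)
      (fun j hj he => by
        have := hu j 2 1 (by omega) (by omega) (fun t ht => by
          obtain rfl : t = 0 := by omega
          exact he)
        omega)
    -- positions below `564 * n` do not see how `u` is continued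
    refine not_matches_deanImage_of_lt hv hp hp' (i := i) fun t ht => ?_
    rw [deanImage_congr hvu (by omega), deanImage_congr hvu (by omega)]
    exact hm t (by omega)
  · obtain ⟨k, rfl⟩ := dvd_of_matches_deanImage (by omega) hm
    obtain ⟨a, j, hmu, h1, h2, h3⟩ := exists_matches_of_matches_deanImage (by omega) hm
    have := hu a k j (by omega) (by omega) hmu
    omega

theorem isPlusFreeWord_deanImage {u : ℕ → Fin 4} {n : ℕ}
    (hu : IsPlusFreeWord (7 / 5) (wordFactors (prefixOf u n))) :
    IsPlusFreeWord (27 / 16) (wordFactors (prefixOf (deanImage u) (564 * n))) := by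
  rw [isPlusFreeWord_prefixOf_iff (by norm_num)] at hu ⊢
  intro i p l hp hn hm
  have hp' : (0 : ℚ) < p := by exact_mod_cast hp
  have := le_of_matches_deanImage (fun i p l hp hn hm => ?_) hp hn hm
  · rw [div_le_iff₀ hp']
    have h : (16 * l : ℚ) ≤ 11 * p := by exact_mod_cast this
    push_cast
    linarith
  · have hp' : (0 : ℚ) < p := by exact_mod_cast hp
    have h := hu i p l hp hn hm
    rw [div_le_iff₀ hp'] at h
    push_cast at h
    have : (5 * l : ℚ) ≤ 2 * p := by linarith
    exact_mod_cast this

/-! ### The code of a `7/5⁺`-free word over four letters -/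

/-- The uniform morphism whose fixed point is the Pansiot code of a `7/5⁺`-free word. -/
def pansiotMorphism (b : Bool) : List Bool :=
  (digitWord 78 (cond b
    101101010110110101011011010110110101101101010110110101011010101101101011011010
    101101010110110101011011010110110101101101011011010101101101011011010110110101)).map lowBit

theorem length_pansiotMorphism : ∀ b, (pansiotMorphism b).length = 78 := by
  decide +kernel

/-- The fixed point of `pansiotMorphism`: position `n` is reached from the letter `true` by
successively choosing the letters at the positions given by the base 78 digits of `n`. -/
def pansiotCode (n : ℕ) : Bool :=
  (Nat.digits 78 n).foldr (fun d b => (pansiotMorphism b).getD d false) true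

theorem pansiotCode_zero : pansiotCode 0 = true := by
  simp [pansiotCode]

theorem getD_pansiotMorphism_zero : ∀ b, (pansiotMorphism b).getD 0 false = true := by
  decide +kernel

theorem pansiotCode_add (m : ℕ) {r : ℕ} (hr : r < 78) :
    pansiotCode (78 * m + r) = (pansiotMorphism (pansiotCode m)).getD r false := by
  rcases Nat.eq_zero_or_pos (78 * m + r) with h | h
  · obtain rfl : r = 0 := by omega
    obtain rfl : m = 0 := by omega
    rw [getD_pansiotMorphism_zero, Nat.mul_zero, Nat.add_zero, pansiotCode_zero]
  · have h1 : (78 * m + r) % 78 = r := by omega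
    have h2 : (78 * m + r) / 78 = m := by omega
    rw [pansiotCode, Nat.digits_def' (by norm_num) h, h1, h2, List.foldr_cons, pansiotCode]

theorem getElem?_pansiotMorphism (m r : ℕ) (hr : r < 78) :
    (pansiotMorphism (pansiotCode m))[r]? = some (pansiotCode (78 * m + r)) := by
  rw [pansiotCode_add m hr, List.getD_eq_getElem?_getD,
    List.getElem?_eq_getElem (by rw [length_pansiotMorphism]; exact hr)]
  rfl

theorem prefixOf_pansiotCode (n : ℕ) :
    (prefixOf pansiotCode n).flatMap pansiotMorphism = prefixOf pansiotCode (78 * n) :=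
  flatMap_prefixOf length_pansiotMorphism getElem?_pansiotMorphism n

theorem prefixOf_pansiotCode_four : prefixOf pansiotCode 4 = [true, false, true, true] := by
  have h : ∀ r < 4, pansiotCode r = (pansiotMorphism true).getD r false := fun r hr => by
    simpa [pansiotCode_zero] using pansiotCode_add 0 (r := r) (by omega)
  have e : prefixOf pansiotCode 4 = [pansiotCode 0, pansiotCode 1, pansiotCode 2, pansiotCode 3] :=
    rfl
  rw [e, h 0 (by omega), h 1 (by omega), h 2 (by omega), h 3 (by omega)]
  decide +kernel

theorem pansiotCode_congr {m j n : ℕ} (h : ∀ t < n, pansiotCode (m + t) = pansiotCode (j + t)) :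
    ∀ t < 78 * n, pansiotCode (78 * m + t) = pansiotCode (78 * j + t) := by
  intro t ht
  have h1 : 78 * m + t = 78 * (m + t / 78) + t % 78 := by omega
  have h2 : 78 * j + t = 78 * (j + t / 78) + t % 78 := by omega
  rw [h1, h2, pansiotCode_add _ (by omega), pansiotCode_add _ (by omega), h _ (by omega)]

theorem pansiotMorphism_adjacent : ∀ b, ∀ r < 77,
    (pansiotMorphism b).getD r false = true ∨ (pansiotMorphism b).getD (r + 1) false = true := by
  decide +kernel

/-- Two consecutive bits are not both unset. -/
theorem pansiotCode_adjacent (n : ℕ) : pansiotCode n = true ∨ pansiotCode (n + 1) = true := by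
  have h1 : n = 78 * (n / 78) + n % 78 := by omega
  rcases lt_or_ge (n % 78) 77 with h | h
  · have h2 : n + 1 = 78 * (n / 78) + (n % 78 + 1) := by omega
    rw [h1, pansiotCode_add _ (by omega), ← h1, h2, pansiotCode_add _ (by omega)]
    exact pansiotMorphism_adjacent _ _ h
  · have h2 : n + 1 = 78 * (n / 78 + 1) + 0 := by omega
    right
    rw [h2, pansiotCode_add _ (by omega), getD_pansiotMorphism_zero]

/-! ### Synchronization of the Pansiot code -/

/-- A word that occurs in the fixed point only at position 4 of the images of the letters. -/
def pansiotMarker : List Bool := (digitWord 20 01010110110101011011).map lowBit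

/-- The first 20 letters of the images of both letters. -/
def pansiotPrefix : List Bool := (pansiotMorphism true).take 20

theorem take_pansiotMorphism : ∀ b, (pansiotMorphism b).take 20 = pansiotPrefix := by
  decide +kernel

theorem pansiotMarker_prefix_drop : ∀ b, pansiotMarker <+: (pansiotMorphism b).drop 4 := by
  decide +kernel

theorem not_pansiotMarker_prefix_drop : ∀ b,
    ∀ x ∈ ((pansiotMorphism b ++ pansiotPrefix).tails.take 78).zipIdx,
      x.2 ≠ 4 → ¬ pansiotMarker <+: x.1 := by
  decide +kernel

theorem length_pansiotMarker : pansiotMarker.length = 20 := by decide +kernel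

theorem pansiotMorphism_injective : ∀ b b', pansiotMorphism b = pansiotMorphism b' → b = b' := by
  decide +kernel

theorem pansiotCode_marker {n : ℕ} (hn : n % 78 = 4) {t : ℕ} (ht : t < 20) :
    pansiotMarker[t]? = some (pansiotCode (n + t)) := by
  have h := List.prefix_iff_getElem?.1 (pansiotMarker_prefix_drop (pansiotCode (n / 78))) t
    (by rw [length_pansiotMarker]; exact ht)
  rw [← List.getElem?_eq_getElem, List.getElem?_drop,
    getElem?_pansiotMorphism _ _ (by omega)] at h
  rw [← h]
  congr 2
  omega

theorem getElem?_append_pansiotPrefix (n : ℕ) {x : ℕ} (hx : x < 98) :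
    (pansiotMorphism (pansiotCode n) ++ pansiotPrefix)[x]? = some (pansiotCode (78 * n + x)) := by
  rcases lt_or_ge x 78 with h | h
  · rw [List.getElem?_append_left (by rw [length_pansiotMorphism]; exact h),
      getElem?_pansiotMorphism n x h]
  · rw [List.getElem?_append_right (by rw [length_pansiotMorphism]; exact h),
      length_pansiotMorphism, ← take_pansiotMorphism (pansiotCode (n + 1)),
      List.getElem?_take_of_lt (by omega), getElem?_pansiotMorphism (n + 1) _ (by omega),
      show 78 * (n + 1) + (x - 78) = 78 * n + x by omega]

theorem length_append_pansiotPrefix : ∀ b, (pansiotMorphism b ++ pansiotPrefix).length = 98 := by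
  decide +kernel

theorem mod_eq_of_pansiotMarker {n : ℕ}
    (h : ∀ t < 20, pansiotMarker[t]? = some (pansiotCode (n + t))) : n % 78 = 4 := by
  by_contra hne
  refine not_pansiotMarker_prefix_drop (pansiotCode (n / 78))
    ((pansiotMorphism (pansiotCode (n / 78)) ++ pansiotPrefix).drop (n % 78), n % 78) ?_ hne ?_
  · apply List.mem_of_getElem? (i := n % 78)
    rw [List.getElem?_zipIdx, List.getElem?_take_of_lt (by omega),
      getElem?_tails _ (by rw [length_append_pansiotPrefix]; omega)]
    simp
  · refine List.prefix_iff_getElem?.2 fun t ht => ?_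
    have ht' : t < 20 := by rwa [length_pansiotMarker] at ht
    rw [List.getElem?_drop, getElem?_append_pansiotPrefix _ (by omega),
      ← List.getElem?_eq_getElem ht, h t ht']
    congr 2
    omega

/-- Any `97 = 77 + 20` consecutive bits contain an occurrence of the marker. -/
theorem dvd_of_matches_pansiotCode {i p e : ℕ} (he : 97 ≤ e) (h : Matches pansiotCode i p e) :
    78 ∣ p := by
  obtain ⟨s, hs, hs'⟩ : ∃ s ≤ 77, (i + s) % 78 = 4 := by
    refine ⟨(4 + 78 - i % 78) % 78, by omega, by omega⟩
  have h2 : (i + s + p) % 78 = 4 := by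
    refine mod_eq_of_pansiotMarker fun t ht => ?_
    rw [pansiotCode_marker hs' ht]
    have := h (s + t) (by omega)
    rw [← Nat.add_assoc] at this
    rw [this]
    congr 2
    omega
  omega

/-! ### Decoding -/

/-- Three consecutive letters and the missing one, moved one letter ahead: the new letter is the
missing one if the bit is set, and the one that leaves the window otherwise. -/
def pansiotStep {α : Type} (s : α × α × α × α) (b : Bool) : α × α × α × α :=
  (s.2.1, s.2.2.1, cond b (s.2.2.2, s.1) (s.1, s.2.2.2))

/-- The window at position `n` of the word over four letters with the given code: the letters at
positions `n`, `n + 1`, `n + 2` and the missing letter. -/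
def pansiotState (c : ℕ → Bool) (n : ℕ) : Fin 4 × Fin 4 × Fin 4 × Fin 4 :=
  Nat.rec (0, 1, 2, 3) (fun n s => pansiotStep s (c n)) n

/-- The word over four letters with the given code. -/
def pansiotWord (c : ℕ → Bool) (n : ℕ) : Fin 4 := (pansiotState c n).1

theorem pansiotState_succ (c : ℕ → Bool) (n : ℕ) :
    pansiotState c (n + 1) = pansiotStep (pansiotState c n) (c n) := rfl

theorem pansiotWord_add_one (c : ℕ → Bool) (n : ℕ) :
    pansiotWord c (n + 1) = (pansiotState c n).2.1 := rfl

theorem pansiotWord_add_two (c : ℕ → Bool) (n : ℕ) :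
    pansiotWord c (n + 2) = (pansiotState c n).2.2.1 := rfl

/-- The four letters are distinct. -/
def IsDistinctState (s : Fin 4 × Fin 4 × Fin 4 × Fin 4) : Prop :=
  s.1 ≠ s.2.1 ∧ s.1 ≠ s.2.2.1 ∧ s.1 ≠ s.2.2.2 ∧ s.2.1 ≠ s.2.2.1 ∧ s.2.1 ≠ s.2.2.2 ∧
    s.2.2.1 ≠ s.2.2.2

theorem IsDistinctState.pansiotStep {s : Fin 4 × Fin 4 × Fin 4 × Fin 4} (h : IsDistinctState s)
    (b : Bool) : IsDistinctState (pansiotStep s b) := by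
  obtain ⟨h1, h2, h3, h4, h5, h6⟩ := h
  cases b
  · exact ⟨h4, h1.symm, h5, h2.symm, h6, h3⟩
  · exact ⟨h4, h5, h1.symm, h6, h2.symm, h3.symm⟩

theorem isDistinctState_pansiotState (c : ℕ → Bool) (n : ℕ) :
    IsDistinctState (pansiotState c n) := by
  induction n with
  | zero =>
    change IsDistinctState (0, 1, 2, 3)
    unfold IsDistinctState
    decide
  | succ n ih => exact ih.pansiotStep (c n)

/-- Renaming the letters of a window. -/
def mapState (f : Fin 4 → Fin 4) (s : Fin 4 × Fin 4 × Fin 4 × Fin 4) :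
    Fin 4 × Fin 4 × Fin 4 × Fin 4 :=
  (f s.1, f s.2.1, f s.2.2.1, f s.2.2.2)

theorem pansiotStep_mapState (f : Fin 4 → Fin 4) (s : Fin 4 × Fin 4 × Fin 4 × Fin 4) (b : Bool) :
    pansiotStep (mapState f s) b = mapState f (pansiotStep s b) := by
  cases b <;> rfl

theorem IsDistinctState.exists_injective {s : Fin 4 × Fin 4 × Fin 4 × Fin 4}
    (h : IsDistinctState s) : ∃ f : Fin 4 → Fin 4, Function.Injective f ∧
      mapState f (0, 1, 2, 3) = s := by
  obtain ⟨a, b, c, d⟩ := s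
  obtain ⟨h1, h2, h3, h4, h5, h6⟩ := h
  refine ⟨![a, b, c, d], ?_, rfl⟩
  intro x y hxy
  fin_cases x <;> fin_cases y <;> simp_all

/-- Up to a renaming of the letters, the word from position `i` on is coded by the code from
position `i` on. -/
theorem exists_pansiotWord_add (c : ℕ → Bool) (i : ℕ) : ∃ f : Fin 4 → Fin 4,
    Function.Injective f ∧ ∀ t, pansiotWord c (i + t) = f (pansiotWord (fun j => c (i + j)) t) := by
  obtain ⟨f, hf, hs⟩ := (isDistinctState_pansiotState c i).exists_injective
  refine ⟨f, hf, fun t => ?_⟩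
  have : pansiotState c (i + t) = mapState f (pansiotState (fun j => c (i + j)) t) := by
    induction t with
    | zero => exact hs.symm
    | succ t ih =>
      rw [pansiotState_succ, ← pansiotStep_mapState, ← ih]
      rfl
  rw [pansiotWord, this]
  rfl

theorem matches_pansiotWord_add {c : ℕ → Bool} {i p l : ℕ} :
    Matches (pansiotWord c) i p l ↔ Matches (pansiotWord fun j => c (i + j)) 0 p l := by
  obtain ⟨f, hf, h⟩ := exists_pansiotWord_add c i
  refine forall₂_congr fun t _ => ?_
  rw [Nat.add_assoc, h, h, hf.eq_iff, Nat.zero_add]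

theorem pansiotState_congr {c c' : ℕ → Bool} {n : ℕ} (h : ∀ t < n, c t = c' t) :
    pansiotState c n = pansiotState c' n := by
  induction n with
  | zero => rfl
  | succ n ih =>
    rw [pansiotState_succ, pansiotState_succ, ih fun t ht => h t (by omega), h n (by omega)]

theorem Matches.pansiotWord_congr {c : ℕ → Bool} {i j p l : ℕ}
    (h : ∀ t < p + l, c (i + t) = c (j + t)) (hm : Matches (pansiotWord c) i p l) :
    Matches (pansiotWord c) j p l := by
  rw [matches_pansiotWord_add] at hm ⊢
  intro t ht
  have e : ∀ x, x < p + l → pansiotWord (fun t => c (j + t)) x = pansiotWord (fun t => c (i + t)) x :=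
    fun x hx => by
      rw [pansiotWord, pansiotWord, pansiotState_congr fun t ht => (h t (by omega)).symm]
  rw [e _ (by omega), e _ (by omega)]
  exact hm t ht

theorem eq_of_first_three_eq : ∀ a b c d d' : Fin 4, IsDistinctState (a, b, c, d) →
    IsDistinctState (a, b, c, d') → d = d' := by
  unfold IsDistinctState
  decide +kernel

theorem pansiotState_eq_of_matches {c : ℕ → Bool} {i p e : ℕ}
    (h : Matches (pansiotWord c) i p (e + 3)) {t : ℕ} (ht : t ≤ e) :
    pansiotState c (i + t) = pansiotState c (i + t + p) := by
  have h0 := h t (by omega)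
  have h1 := h (t + 1) (by omega)
  have h2 := h (t + 2) (by omega)
  rw [← Nat.add_assoc, pansiotWord_add_one, show i + t + 1 + p = i + t + p + 1 by omega,
    pansiotWord_add_one] at h1
  rw [← Nat.add_assoc, pansiotWord_add_two, show i + t + 2 + p = i + t + p + 2 by omega,
    pansiotWord_add_two] at h2
  have d1 := isDistinctState_pansiotState c (i + t)
  have d2 := isDistinctState_pansiotState c (i + t + p)
  rw [pansiotWord, pansiotWord] at h0
  generalize pansiotState c (i + t) = s at *
  generalize pansiotState c (i + t + p) = s' at *
  obtain ⟨a, b, c, d⟩ := s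
  obtain ⟨a', b', c', d'⟩ := s'
  simp only at h0 h1 h2
  subst h0 h1 h2
  rw [eq_of_first_three_eq _ _ _ _ _ d1 d2]

theorem IsDistinctState.pansiotStep_injective {s : Fin 4 × Fin 4 × Fin 4 × Fin 4}
    (h : IsDistinctState s) {b b' : Bool} (hb : _root_.pansiotStep s b = _root_.pansiotStep s b') :
    b = b' := by
  obtain ⟨-, -, h3, -⟩ := h
  cases b <;> cases b' <;> simp_all [_root_.pansiotStep]

/-- A match in the word is a match in the code; three letters are needed to determine a window. -/
theorem matches_code_of_matches {c : ℕ → Bool} {i p e : ℕ}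
    (h : Matches (pansiotWord c) i p (e + 3)) : Matches c i p e := by
  intro t ht
  have h0 := pansiotState_eq_of_matches h ht.le
  have h1 := pansiotState_eq_of_matches h (t := t + 1) ht
  rw [← Nat.add_assoc, pansiotState_succ, show i + t + 1 + p = i + t + p + 1 by omega,
    pansiotState_succ, ← h0] at h1
  exact (isDistinctState_pansiotState c (i + t)).pansiotStep_injective h1

/-- A match in the code gives a match in the word if the windows at the two starting points agree. -/
theorem matches_of_matches_code {c : ℕ → Bool} {i p e : ℕ}
    (h0 : pansiotState c i = pansiotState c (i + p)) (h : Matches c i p e) :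
    Matches (pansiotWord c) i p (e + 3) := by
  have hs : ∀ t ≤ e, pansiotState c (i + t) = pansiotState c (i + t + p) := by
    intro t ht
    induction t with
    | zero => simpa using h0
    | succ t ih =>
      rw [← Nat.add_assoc, pansiotState_succ, show i + t + 1 + p = i + t + p + 1 by omega,
        pansiotState_succ, ← ih (by omega), h t (by omega)]
  intro t ht
  rcases Nat.lt_or_ge e t with h1 | h1
  · obtain rfl | rfl : t = e + 1 ∨ t = e + 2 := by omega
    · rw [← Nat.add_assoc, pansiotWord_add_one, hs e le_rfl,
        show i + e + 1 + p = i + e + p + 1 by omega, pansiotWord_add_one]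
    · rw [← Nat.add_assoc, pansiotWord_add_two, hs e le_rfl,
        show i + e + 2 + p = i + e + p + 2 by omega, pansiotWord_add_two]
  · rw [pansiotWord, hs t h1, pansiotWord]

/-! ### The state at block boundaries -/

/-- The image of a bit acts on the windows in the same way as the bit. -/
theorem foldl_pansiotMorphism : ∀ (b : Bool) (s : Fin 4 × Fin 4 × Fin 4 × Fin 4),
    (pansiotMorphism b).foldl pansiotStep s = pansiotStep s b := by
  rintro b ⟨x, y, z, w⟩
  revert b x y z w
  decide +kernel

theorem foldl_prefixOf (c : ℕ → Bool) (n k : ℕ) :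
    (prefixOf (fun j => c (n + j)) k).foldl pansiotStep (pansiotState c n) =
      pansiotState c (n + k) := by
  induction k with
  | zero => simp [prefixOf]
  | succ k ih =>
    have : prefixOf (fun j => c (n + j)) (k + 1) = prefixOf (fun j => c (n + j)) k ++ [c (n + k)] := by
      simp [prefixOf, List.range_succ]
    rw [this, List.foldl_append, ih]
    rfl

theorem pansiotMorphism_eq_prefixOf (m : ℕ) :
    pansiotMorphism (pansiotCode m) = prefixOf (fun j => pansiotCode (78 * m + j)) 78 :=
  eq_prefixOf (length_pansiotMorphism _) (getElem?_pansiotMorphism m)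

theorem pansiotState_mul (m : ℕ) : pansiotState pansiotCode (78 * m) = pansiotState pansiotCode m := by
  induction m with
  | zero => rfl
  | succ m ih =>
    rw [Nat.mul_succ, ← foldl_prefixOf, ← pansiotMorphism_eq_prefixOf, foldl_pansiotMorphism, ih,
      pansiotState_succ]

/-- A long match comes from a match whose period is smaller by the factor 78. -/
theorem exists_matches_of_matches_pansiotWord {i k e : ℕ} (he : 97 ≤ e)
    (h : Matches (pansiotWord pansiotCode) i (78 * k) (e + 3)) :
    ∃ a j, Matches (pansiotWord pansiotCode) a k (j + 3) ∧ e ≤ 78 * j + 154 := by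
  have hc := matches_code_of_matches h
  -- the whole blocks covered by the match are those from `(i + 77) / 78` to `(i + e) / 78 - 1`
  refine ⟨(i + 77) / 78, (i + e) / 78 - (i + 77) / 78, matches_of_matches_code ?_ ?_, by omega⟩
  · have := pansiotState_eq_of_matches h (t := 78 * ((i + 77) / 78) - i) (by omega)
    rw [show i + (78 * ((i + 77) / 78) - i) = 78 * ((i + 77) / 78) by omega, ← Nat.mul_add,
      pansiotState_mul, pansiotState_mul] at this
    exact this
  · intro t ht
    apply pansiotMorphism_injective
    rw [pansiotMorphism_eq_prefixOf]
    refine (eq_prefixOf (length_pansiotMorphism _) fun r hr => ?_).symm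
    rw [getElem?_pansiotMorphism _ _ hr]
    have := hc (78 * ((i + 77) / 78 + t) + r - i) (by omega)
    rw [show i + (78 * ((i + 77) / 78 + t) + r - i) = 78 * ((i + 77) / 78 + t) + r by omega] at this
    rw [this]
    congr 2
    omega

/-! ### Short periods of the Pansiot word -/

/-- The first letters of the windows that the code word passes through, from the window with the
letters `a`, `b`, `c` and the missing letter `d` on. -/
def pansiotLetters : List Bool → Fin 4 → Fin 4 → Fin 4 → Fin 4 → List (Fin 4) := fun l =>
  List.rec (fun _ _ _ _ => [])
    (fun x _ ih a b c d => a :: cond x (ih b c d a) (ih b c a d)) l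

theorem getElem?_pansiotLetters {l : List Bool} {s : Fin 4 × Fin 4 × Fin 4 × Fin 4} {r : ℕ}
    (hr : r < l.length) : (pansiotLetters l s.1 s.2.1 s.2.2.1 s.2.2.2)[r]? =
      some ((l.take r).foldl pansiotStep s).1 := by
  induction l generalizing s r with
  | nil => simp at hr
  | cons x l ih =>
    have hdef : pansiotLetters (x :: l) s.1 s.2.1 s.2.2.1 s.2.2.2 =
        s.1 :: pansiotLetters l (pansiotStep s x).1 (pansiotStep s x).2.1 (pansiotStep s x).2.2.1
          (pansiotStep s x).2.2.2 := by
      cases x <;> rfl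
    rw [hdef]
    cases r with
    | zero => rfl
    | succ r =>
      rw [List.getElem?_cons_succ, ih (by simpa using hr)]
      rfl

theorem length_pansiotLetters (l : List Bool) (a b c d : Fin 4) :
    (pansiotLetters l a b c d).length = l.length := by
  induction l generalizing a b c d with
  | nil => rfl
  | cons x l ih =>
    cases x
    · exact congrArg Nat.succ (ih b c a d)
    · exact congrArg Nat.succ (ih b c d a)

/-- The words coded by the images of the given bits, of 78 letters each, as numbers with the bits
`bit` of the letters. By `foldl_pansiotMorphism`, the window after the image of a bit is the one after
the bit itself. -/
def pansiotPlanes (bit : Fin 4 → Bool) :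
    List Bool → Fin 4 → Fin 4 → Fin 4 → Fin 4 → List ℕ := fun l =>
  List.rec (fun _ _ _ _ => [])
    (fun x _ ih a b c d => ofBitList ((pansiotLetters (pansiotMorphism x) a b c d).map bit) ::
      cond x (ih b c d a) (ih b c a d)) l

theorem getElem?_pansiotPlanes {bit : Fin 4 → Bool} {l : List Bool}
    {s : Fin 4 × Fin 4 × Fin 4 × Fin 4} {n : ℕ} {x : Bool} (hx : l[n]? = some x) :
    (pansiotPlanes bit l s.1 s.2.1 s.2.2.1 s.2.2.2)[n]? =
      some (ofBitList ((pansiotLetters (pansiotMorphism x) ((l.take n).foldl pansiotStep s).1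
        ((l.take n).foldl pansiotStep s).2.1 ((l.take n).foldl pansiotStep s).2.2.1
        ((l.take n).foldl pansiotStep s).2.2.2).map bit)) := by
  induction l generalizing s n with
  | nil => simp at hx
  | cons y l ih =>
    have hdef : pansiotPlanes bit (y :: l) s.1 s.2.1 s.2.2.1 s.2.2.2 =
        ofBitList ((pansiotLetters (pansiotMorphism y) s.1 s.2.1 s.2.2.1 s.2.2.2).map bit) ::
          pansiotPlanes bit l (pansiotStep s y).1 (pansiotStep s y).2.1 (pansiotStep s y).2.2.1
            (pansiotStep s y).2.2.2 := by
      cases y <;> rfl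
    rw [hdef]
    cases n with
    | zero =>
      obtain rfl : y = x := by simpa using hx
      rfl
    | succ n =>
      rw [List.getElem?_cons_succ, ih (by simpa using hx)]
      rfl

theorem pansiotPlanes_lt {bit : Fin 4 → Bool} {l : List Bool} {a b c d : Fin 4} :
    ∀ n ∈ pansiotPlanes bit l a b c d, n < 2 ^ 78 := by
  have h : ∀ x a b c d, ofBitList ((pansiotLetters (pansiotMorphism x) a b c d).map bit) < 2 ^ 78 :=
    fun x a b c d => by
      have := ofBitList_lt ((pansiotLetters (pansiotMorphism x) a b c d).map bit)
      rwa [List.length_map, length_pansiotLetters, length_pansiotMorphism] at this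
  induction l generalizing a b c d with
  | nil => intro n hn; exact absurd hn List.not_mem_nil
  | cons x l ih =>
    have hdef : pansiotPlanes bit (x :: l) a b c d =
        ofBitList ((pansiotLetters (pansiotMorphism x) a b c d).map bit) ::
          cond x (pansiotPlanes bit l b c d a) (pansiotPlanes bit l b c a d) := by
      cases x <;> rfl
    rw [hdef, List.forall_mem_cons]
    refine ⟨h x a b c d, ?_⟩
    cases x
    · exact ih
    · exact ih

/-- The bits of the first `4 * 78 ^ 2` letters of the Pansiot word. -/
def pansiotPlane (bit : Fin 4 → Bool) : ℕ :=
  concatBlocks 78 (pansiotPlanes bit ([true, false, true, true].flatMap pansiotMorphism) 0 1 2 3)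

theorem testBit_pansiotPlane (bit : Fin 4 → Bool) {n : ℕ} (hn : n < 24336) :
    (pansiotPlane bit).testBit n = bit (pansiotWord pansiotCode n) := by
  obtain ⟨m, r, hr, rfl⟩ : ∃ m r, r < 78 ∧ n = 78 * m + r :=
    ⟨n / 78, n % 78, by omega, by omega⟩
  have hl : [true, false, true, true].flatMap pansiotMorphism = prefixOf pansiotCode 312 := by
    rw [← prefixOf_pansiotCode_four, prefixOf_pansiotCode]
  have take : ∀ i k N, k ≤ N → (prefixOf (fun j => pansiotCode (i + j)) N).take k =
      prefixOf (fun j => pansiotCode (i + j)) k := by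
    intro i k N hk
    refine eq_prefixOf (by simp; omega) fun t ht => ?_
    rw [List.getElem?_take_of_lt ht, getElem?_prefixOf _ (by omega)]
  have hstate : ((prefixOf pansiotCode 312).take m).foldl pansiotStep (0, 1, 2, 3) =
      pansiotState pansiotCode (78 * m) := by
    have e := take 0 m 312 (by omega)
    simp only [Nat.zero_add] at e
    have e' := foldl_prefixOf pansiotCode 0 m
    simp only [Nat.zero_add] at e'
    rw [e, pansiotState_mul, ← e']
    rfl
  have h := getElem?_pansiotPlanes (bit := bit) (s := (0, 1, 2, 3))
    (getElem?_prefixOf pansiotCode (n := 312) (i := m) (by omega))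
  rw [hstate] at h
  rw [pansiotPlane, hl, testBit_concatBlocks pansiotPlanes_lt h hr]
  apply testBit_ofBitList
  rw [List.getElem?_map, getElem?_pansiotLetters (by rw [length_pansiotMorphism]; exact hr),
    pansiotMorphism_eq_prefixOf, take _ _ _ hr.le, foldl_prefixOf]
  rfl

/-- The prefix consists of four blocks of length `6084 = 78 ^ 2`; the match begins in one of the first
three, and ends in this block or the next one. -/
theorem noMatches_pansiotWord :
    (evalThen (pansiotPlane lowBit) fun A => evalThen (pansiotPlane highBit) fun B =>
      noMatches 2 5 A B (3 * 6084) 251) = true := by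
  decide +kernel

/-- Short periods: up to a renaming of the letters, a match violating the bound occurs in the first
four blocks of the second power of the morphism. -/
theorem not_matches_pansiotWord_of_lt {i p : ℕ} (hp : 0 < p) (hp' : p < 251) :
    ¬ Matches (pansiotWord pansiotCode) i p (2 * p / 5 + 1) := by
  intro hm
  -- every pair of consecutive bits occurs among the first four bits
  obtain ⟨j, hj, hc⟩ : ∃ j < 3, ∀ t < 2, pansiotCode (i / 6084 + t) = pansiotCode (j + t) := by
    have h4 : ∀ t < 4, pansiotCode t = [true, false, true, true].getD t false := fun t ht => by
      rw [← prefixOf_pansiotCode_four, List.getD_eq_getElem?_getD, getElem?_prefixOf _ ht]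
      rfl
    have two : ∀ j < 3, pansiotCode (i / 6084) = [true, false, true, true].getD j false →
        pansiotCode (i / 6084 + 1) = [true, false, true, true].getD (j + 1) false →
        ∀ t < 2, pansiotCode (i / 6084 + t) = pansiotCode (j + t) := by
      intro j hj h0 h1 t ht
      obtain rfl | rfl : t = 0 ∨ t = 1 := by omega
      · rw [Nat.add_zero, Nat.add_zero, h4 j (by omega), h0]
      · rw [h4 (j + 1) (by omega), h1]
    have hadj := pansiotCode_adjacent (i / 6084)
    cases h0 : pansiotCode (i / 6084) <;> cases h1 : pansiotCode (i / 6084 + 1)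
    · simp [h0, h1] at hadj
    · exact ⟨1, by omega, two 1 (by omega) h0 h1⟩
    · exact ⟨0, by omega, two 0 (by omega) h0 h1⟩
    · exact ⟨2, by omega, two 2 (by omega) h0 h1⟩
  have hc' := pansiotCode_congr (pansiotCode_congr hc)
  have hm' : Matches (pansiotWord pansiotCode) (6084 * j + i % 6084) p (2 * p / 5 + 1) := by
    refine hm.pansiotWord_congr fun t ht => ?_
    have := hc' (i % 6084 + t) (by omega)
    rw [← Nat.mul_assoc, ← Nat.mul_assoc] at this
    rw [show i + t = 78 * 78 * (i / 6084) + (i % 6084 + t) by omega, this, Nat.add_assoc]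
  have hno := noMatches_pansiotWord
  simp only [evalThen_eq] at hno
  obtain ⟨t, ht, hne⟩ := exists_ne_of_noMatch (by omega) (noMatch_of_noMatches hno hp hp')
    (i := 6084 * j + i % 6084) (by omega)
  rw [testBit_pansiotPlane _ (by omega), testBit_pansiotPlane _ (by omega),
    testBit_pansiotPlane _ (by omega), testBit_pansiotPlane _ (by omega), hm' t ht] at hne
  simp at hne

/-- A violation with `p ≥ 251` has length at least `101 > 97 + 3`, so that it comes from a violation
with period `p / 78`. -/
theorem le_of_matches_pansiotWord (p : ℕ) : ∀ i l, 0 < p →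
    Matches (pansiotWord pansiotCode) i p l → 5 * l ≤ 2 * p := by
  induction p using Nat.strong_induction_on with
  | _ p ih =>
    intro i l hp hm
    by_contra hlt
    rcases lt_or_ge p 251 with hp' | hp'
    · exact not_matches_pansiotWord_of_lt hp hp' (hm.mono (by omega))
    · obtain ⟨e, rfl⟩ : ∃ e, l = e + 3 := ⟨l - 3, by omega⟩
      obtain ⟨k, rfl⟩ := dvd_of_matches_pansiotCode (by omega) (matches_code_of_matches hm)
      obtain ⟨a, j, hmj, hj⟩ := exists_matches_of_matches_pansiotWord (by omega) hm
      have := ih k (by omega) a (j + 3) (by omega) hmj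
      omega

theorem isPlusFreeWord_pansiotWord : IsPlusFreeWord (7 / 5) (infFactors (pansiotWord pansiotCode)) := by
  refine isPlusFreeWord_infFactors fun n => ?_
  rw [isPlusFreeWord_prefixOf_iff (by norm_num)]
  intro i p l hp _ hm
  have hp' : (0 : ℚ) < p := by exact_mod_cast hp
  have h : (5 * l : ℚ) ≤ 2 * p := by exact_mod_cast le_of_matches_pansiotWord p i l hp hm
  rw [div_le_iff₀ hp']
  push_cast
  linarith

/-! ### Directed words as binary words -/

/-- The conditions on the high bits of a `27/16`-free 11-directed Dean word of length `T`: there the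
parities of the letters alternate, so that a letter is given by its position and its high bit. -/
structure IsGoodBits (b : ℕ → Bool) (T : ℕ) : Prop where
  not_matches : ∀ i p l, p % 2 = 0 → 0 < p → i + p + l ≤ T → 11 * p ≤ 16 * l → ¬ Matches b i p l
  directed : ∀ i j, i + 11 ≤ T → j + 11 ≤ T → i % 2 = j % 2 → ¬ ∀ t < 11, b (i + t) = b (j + (10 - t))

theorem IsGoodBits.shift {b : ℕ → Bool} {T : ℕ} (h : IsGoodBits b T) (s : ℕ) {T' : ℕ}
    (hT : s + T' ≤ T) : IsGoodBits (fun n => b (s + n)) T' where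
  not_matches i p l h2 hp hl he hm := by
    refine h.not_matches (s + i) p l h2 hp (by omega) he fun t ht => ?_
    have := hm t ht
    simpa only [Nat.add_assoc] using this
  directed i j hi hj hij hd := by
    refine h.directed (s + i) (s + j) (by omega) (by omega) (by omega) fun t ht => ?_
    have := hd t ht
    simpa only [Nat.add_assoc] using this

/-- The periodic word `eoeo...`. -/
def alternating (e o : Bool) (n : ℕ) : Bool := if n % 2 = 0 then e else o

theorem IsGoodBits.flip {b : ℕ → Bool} {T : ℕ} (h : IsGoodBits b T) (e o : Bool) :
    IsGoodBits (fun n => b n ^^ alternating e o n) T where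
  not_matches i p l h2 hp hl he hm := by
    refine h.not_matches i p l h2 hp hl he fun t ht => ?_
    have := hm t ht
    have e1 : alternating e o (i + t) = alternating e o (i + t + p) := by
      rw [alternating, alternating, show (i + t + p) % 2 = (i + t) % 2 by omega]
    simpa only [e1, Bool.xor_left_inj] using this
  directed i j hi hj hij hd := by
    refine h.directed i j hi hj hij fun t ht => ?_
    have := hd t ht
    have e1 : alternating e o (i + t) = alternating e o (j + (10 - t)) := by
      rw [alternating, alternating, show (i + t) % 2 = (j + (10 - t)) % 2 by omega]
    simpa only [e1, Bool.xor_left_inj] using this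

/-! ### Windows as numbers -/

/-- The number with the binary digits `b i`, ..., `b (i + k - 1)`, the most significant one first. -/
def window (b : ℕ → Bool) (i k : ℕ) : ℕ :=
  Nat.rec 0 (fun k n => 2 * n + (b (i + k)).toNat) k

theorem window_succ (b : ℕ → Bool) (i k : ℕ) :
    window b i (k + 1) = 2 * window b i k + (b (i + k)).toNat := rfl

theorem window_add (b : ℕ → Bool) (i m k : ℕ) :
    window b i (m + k) = 2 ^ k * window b i m + window b (i + m) k := by
  induction k with
  | zero => simp [window]
  | succ k ih =>
    rw [← Nat.add_assoc, window_succ, ih, window_succ, Nat.pow_succ, ← Nat.add_assoc]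
    ring

theorem window_lt (b : ℕ → Bool) (i k : ℕ) : window b i k < 2 ^ k := by
  induction k with
  | zero => simp [window]
  | succ k ih =>
    have : (b (i + k)).toNat < 2 := Bool.toNat_lt _
    rw [window_succ, Nat.pow_succ]
    omega

theorem window_mod (b : ℕ → Bool) {n k : ℕ} (h : k ≤ n) :
    window b 0 n % 2 ^ k = window b (n - k) k := by
  obtain ⟨m, rfl⟩ := Nat.exists_eq_add_of_le' h
  rw [window_add, Nat.mul_add_mod, Nat.mod_eq_of_lt (window_lt _ _ _), Nat.zero_add,
    Nat.add_sub_cancel]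

theorem window_shiftRight (b : ℕ → Bool) {n p : ℕ} (h : p ≤ n) :
    window b 0 n >>> p = window b 0 (n - p) := by
  obtain ⟨m, rfl⟩ := Nat.exists_eq_add_of_le' h
  rw [Nat.shiftRight_eq_div_pow, window_add, Nat.mul_add_div (by positivity),
    Nat.div_eq_of_lt (window_lt _ _ _), Nat.add_sub_cancel, Nat.add_zero]

theorem window_congr {b b' : ℕ → Bool} {i j k : ℕ} (h : ∀ t < k, b (i + t) = b' (j + t)) :
    window b i k = window b' j k := by
  induction k with
  | zero => rfl
  | succ k ih => rw [window_succ, window_succ, ih fun t ht => h t (by omega), h k (by omega)]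

theorem testBit_window (b : ℕ → Bool) (i : ℕ) {k t : ℕ} (ht : t < k) :
    (window b i k).testBit t = b (i + (k - 1 - t)) := by
  induction k generalizing t with
  | zero => omega
  | succ k ih =>
    rw [window_succ]
    cases t with
    | zero => cases h : b (i + k) <;> simp [h]
    | succ t =>
      have h1 : (2 * window b i k + (b (i + k)).toNat) / 2 = window b i k := by
        have : (b (i + k)).toNat < 2 := Bool.toNat_lt _
        omega
      rw [Nat.testBit_succ, h1, ih (by omega)]
      congr 2
      omega

theorem eq_of_window_eq {b b' : ℕ → Bool} {i j k : ℕ} (h : window b i k = window b' j k) {t : ℕ}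
    (ht : t < k) : b (i + t) = b' (j + t) := by
  have h1 := testBit_window b i (k := k) (t := k - 1 - t) (by omega)
  have h2 := testBit_window b' j (k := k) (t := k - 1 - t) (by omega)
  rw [show k - 1 - (k - 1 - t) = t by omega] at h1 h2
  rw [← h1, ← h2, h]

theorem window_xor (b c : ℕ → Bool) (i k : ℕ) :
    window (fun n => b n ^^ c n) i k = window b i k ^^^ window c i k := by
  apply Nat.eq_of_testBit_eq
  intro t
  rcases lt_or_ge t k with h | h
  · rw [Nat.testBit_xor, testBit_window _ _ h, testBit_window _ _ h, testBit_window _ _ h]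
  · have : ∀ b, (window b i k).testBit t = false := fun b =>
      Nat.testBit_lt_two_pow ((window_lt b i k).trans_le (Nat.pow_le_pow_right (by norm_num) h))
    rw [Nat.testBit_xor, this, this, this]
    rfl

/-- The reversed window of length 11. -/
def revWindow (b : ℕ → Bool) (i : ℕ) : ℕ := window (fun t => b (i + (10 - t))) 0 11

theorem revWindow_succ (b : ℕ → Bool) (i : ℕ) :
    revWindow b (i + 1) = revWindow b i / 2 + 1024 * (b (i + 11)).toNat := by
  have h1 : revWindow b i / 2 = window (fun t => b (i + (10 - t))) 0 10 := by
    have : (b (i + (10 - (0 + 10)))).toNat < 2 := Bool.toNat_lt _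
    rw [revWindow, window_succ]
    omega
  have h2 : revWindow b (i + 1) = 2 ^ 10 * (b (i + 11)).toNat +
      window (fun t => b (i + 1 + (10 - t))) (0 + 1) 10 := by
    have h0 : window (fun t => b (i + 1 + (10 - t))) 0 1 = (b (i + 11)).toNat := by
      simp [window, Nat.add_assoc]
    rw [← h0]
    exact window_add _ 0 1 10
  have h3 : window (fun t => b (i + 1 + (10 - t))) (0 + 1) 10 =
      window (fun t => b (i + (10 - t))) 0 10 :=
    window_congr fun t ht => by congr 1; omega
  rw [h2, h3, h1]
  omega

theorem IsGoodBits.window_ne_revWindow {b : ℕ → Bool} {T : ℕ} (h : IsGoodBits b T) {i j : ℕ}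
    (hi : i + 11 ≤ T) (hj : j + 11 ≤ T) (hij : i % 2 = j % 2) : window b i 11 ≠ revWindow b j := by
  intro he
  refine h.directed i j hi hj hij fun t ht => ?_
  rw [eq_of_window_eq he ht, Nat.zero_add]

/-- The window of length 11 is a palindrome, or has a factor of exponent at least `27/16` with
period 2, 4 or 6. -/
def isBadWindow (y : ℕ) : Bool :=
  ((List.range 11).all fun t => y.testBit t == y.testBit (10 - t)) ||
    [(2, 2), (4, 3), (6, 5)].any fun x => (List.range (12 - x.1 - x.2)).any fun i =>
      (List.range x.2).all fun t => y.testBit (i + t) == y.testBit (i + t + x.1)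

theorem IsGoodBits.isBadWindow_eq_false {b : ℕ → Bool} {T : ℕ} (h : IsGoodBits b T) {j : ℕ}
    (hj : j + 11 ≤ T) : isBadWindow (window b j 11) = false := by
  rw [Bool.eq_false_iff]
  intro hb
  rw [isBadWindow, Bool.or_eq_true] at hb
  rcases hb with hb | hb
  · rw [List.all_eq_true] at hb
    refine h.directed j j hj hj rfl fun t ht => ?_
    have := hb t (by simpa using ht)
    rw [testBit_window _ _ ht, testBit_window _ _ (by omega)] at this
    rw [eq_comm]
    simpa [show 10 - (10 - t) = t by omega] using this
  · rw [List.any_eq_true] at hb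
    obtain ⟨⟨p, e⟩, hx, hb⟩ := hb
    have hpe : p % 2 = 0 ∧ 0 < p ∧ 11 * p ≤ 16 * e ∧ p + e ≤ 11 ∧ 0 < e := by
      simp only [List.mem_cons, Prod.mk.injEq, List.not_mem_nil, or_false] at hx
      omega
    obtain ⟨i, hi, hb⟩ := List.any_eq_true.1 hb
    rw [List.all_eq_true] at hb
    have hi' : i < 12 - p - e := by simpa using hi
    refine h.not_matches (j + (11 - i - e - p)) p e hpe.1 hpe.2.1 (by omega) hpe.2.2.1 fun t ht => ?_
    have := hb (e - 1 - t) (by simp; omega)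
    rw [testBit_window _ _ (by omega), testBit_window _ _ (by simp; omega), beq_iff_eq] at this
    rw [show j + (11 - i - e - p) + t = j + (11 - 1 - (i + (e - 1 - t) + p)) by omega, ← this]
    congr 1
    omega

/-- The set of bad windows, as a number. -/
def badWindows : ℕ := ofBitList ((List.range 2048).map isBadWindow)

theorem IsGoodBits.testBit_badWindows {b : ℕ → Bool} {T : ℕ} (h : IsGoodBits b T) {j : ℕ}
    (hj : j + 11 ≤ T) : badWindows.testBit (window b j 11) = false := by
  rw [badWindows, testBit_ofBitList (b := isBadWindow (window b j 11)), h.isBadWindow_eq_false hj]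
  have := window_lt b j 11
  rw [List.getElem?_map, List.getElem?_range (by simpa using this)]
  rfl

/-! ### The search -/

/-- Whether the word `x` of length `n` ends with a match of length `e` at distance `p`, or `r`. The
number `y` consists of the last 16 bits of `x`; it makes for a quick test. -/
def hasSuffixMatch (n x y p e : ℕ) (r : Bool) : Bool :=
  cond (Nat.beq y (Nat.mod (Nat.shiftRight x p) 65536))
    (cond (Nat.beq (Nat.mod x (Nat.pow 2 e)) (Nat.mod (Nat.shiftRight x p) (Nat.pow 2 e)))
      (cond (Nat.ble (Nat.add p e) n) true r) r) r

/-- Whether the word `x` of length `n` has a suffix of exponent at least `27/16` with one of the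
listed periods. -/
def hasBadSuffix (n x : ℕ) : Bool :=
  evalThen (Nat.mod x 65536) fun y =>
    hasSuffixMatch n x y 22 16 <| hasSuffixMatch n x y 24 17 <| hasSuffixMatch n x y 26 18 <|
    hasSuffixMatch n x y 28 20 <| hasSuffixMatch n x y 32 22 <| hasSuffixMatch n x y 36 25 <|
    hasSuffixMatch n x y 48 33 <| hasSuffixMatch n x y 60 42 <| hasSuffixMatch n x y 64 44 <|
    hasSuffixMatch n x y 68 47 <|
    hasSuffixMatch n x (Nat.mod (Nat.shiftRight x 16) 65536) 16 11 false

theorem IsGoodBits.hasSuffixMatch_eq {b : ℕ → Bool} {T n : ℕ} (h : IsGoodBits b T) (hn : n ≤ T)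
    {p e : ℕ} (h2 : p % 2 = 0) (hp : 0 < p) (he : 11 * p ≤ 16 * e) (y : ℕ) (r : Bool) :
    hasSuffixMatch n (window b 0 n) y p e r = r := by
  unfold hasSuffixMatch
  cases h1 : Nat.beq y (Nat.mod (Nat.shiftRight (window b 0 n) p) 65536)
  · rfl
  cases h3 : Nat.beq (Nat.mod (window b 0 n) (Nat.pow 2 e))
    (Nat.mod (Nat.shiftRight (window b 0 n) p) (Nat.pow 2 e))
  · rfl
  cases h4 : Nat.ble (Nat.add p e) n
  · rfl
  · exfalso
    have h3 : window b 0 n % 2 ^ e = (window b 0 n >>> p) % 2 ^ e := Nat.eq_of_beq_eq_true h3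
    have h4 : p + e ≤ n := Nat.le_of_ble_eq_true h4
    rw [window_shiftRight _ (by omega), window_mod _ (by omega), window_mod _ (by omega)] at h3
    refine h.not_matches (n - p - e) p e h2 hp (by omega) he fun t ht => ?_
    rw [← eq_of_window_eq h3 ht]
    congr 1
    omega

theorem IsGoodBits.hasBadSuffix_eq_false {b : ℕ → Bool} {T n : ℕ} (h : IsGoodBits b T)
    (hn : n ≤ T) : hasBadSuffix n (window b 0 n) = false := by
  rw [hasBadSuffix, evalThen_eq]
  iterate 11 rw [h.hasSuffixMatch_eq hn (by norm_num) (by norm_num) (by norm_num)]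

/-- The windows of length 11 that arise from `c` by inverting the bits at all even positions or at
all odd positions or both. -/
def isFlipped (c y : ℕ) : Bool :=
  evalThen (Nat.xor y c) fun m => Nat.beq m 0 || Nat.beq m 682 || Nat.beq m 1365 || Nat.beq m 2047

/-- Whether the word `x` of length `n` ends with a window that no good word of length `T` can have at
this position: the list `K` consists of windows `c` and of lengths `T'` such that no good word of length
`T'` begins with `c`. The test `n ≤ 21` only saves time, as the lengths in `K` are close to `T`. -/
def isExcluded (T : ℕ) (K : List (ℕ × ℕ)) (n x : ℕ) : Bool :=
  cond (Nat.ble n 21)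
    (K.any fun c => Nat.ble (Nat.add n c.2) (Nat.add T 11) && isFlipped c.1 (Nat.mod x 2048)) false

/-- Continues the search at the word `x` of length `n + 1` with the last window `z`, reversed, unless
`x` has a bad suffix. -/
def visit (next : ℕ → ℕ → ℕ → ℕ → ℕ → Bool) (n R S x z : ℕ) : Bool :=
  evalThen x fun x => evalThen z fun z => cond (hasBadSuffix (Nat.succ n) x) true
    (evalThen (Nat.lor R (Nat.pow 2 z)) fun R => next (Nat.succ n) x z S R)

/-- Depth-first search for good words of length `T` that continue the word `x` of length
`n = T - fuel`; the value is `true` if there is none. The number `z` is the last window of length 11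
of `x`, reversed. The numbers `R` and `S` are sets of windows of length 11 that are forbidden at
positions of the parity of `n`, and of the other parity. -/
def search (T : ℕ) (K : List (ℕ × ℕ)) (fuel : ℕ) : ℕ → ℕ → ℕ → ℕ → ℕ → Bool :=
  Nat.rec (fun _ _ _ _ _ => false)
    (fun _ next n x z R S =>
      cond (isExcluded T K n x) true <|
        evalThen (Nat.mod (Nat.shiftRight R (Nat.mul 2 (Nat.mod x 1024))) 4) fun t =>
          cond (cond (Nat.beq (Nat.mod t 2) 1) true (visit next n R S (Nat.mul 2 x) (Nat.div z 2)))
            (cond (Nat.ble 2 t) true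
              (visit next n R S (Nat.succ (Nat.mul 2 x)) (Nat.add (Nat.div z 2) 1024))) false)
    fuel

/-- No good word of length `T` begins with the window `c` of length 11. -/
def Excludes (T c : ℕ) : Prop := ∀ b, IsGoodBits b T → window b 0 11 ≠ c

theorem Excludes.of_isFlipped {T c y : ℕ} (h : Excludes T c) (hy : isFlipped c y = true) :
    Excludes T y := by
  have key : ∀ e o, y ^^^ c = window (alternating e o) 0 11 → Excludes T y := by
    intro e o hm b hb hw
    refine h _ (hb.flip e o) ?_
    rw [window_xor, hw, ← hm, ← Nat.xor_assoc, Nat.xor_self, Nat.zero_xor]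
  rw [isFlipped, evalThen_eq] at hy
  simp only [Bool.or_eq_true] at hy
  rcases hy with ((hy | hy) | hy) | hy
  · exact key false false (Nat.eq_of_beq_eq_true hy)
  · exact key false true (Nat.eq_of_beq_eq_true hy)
  · exact key true false (Nat.eq_of_beq_eq_true hy)
  · exact key true true (Nat.eq_of_beq_eq_true hy)

theorem IsGoodBits.isExcluded_eq_false {b : ℕ → Bool} {T n : ℕ} (h : IsGoodBits b T)
    (hn' : 11 ≤ n) {K : List (ℕ × ℕ)} (hK : ∀ c ∈ K, Excludes c.2 c.1) :
    isExcluded T K n (window b 0 n) = false := by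
  rw [Bool.eq_false_iff]
  intro hb
  unfold isExcluded at hb
  cases h21 : Nat.ble n 21
  · rw [h21] at hb
    exact Bool.false_ne_true hb
  · rw [h21, Bool.cond_true, List.any_eq_true] at hb
    obtain ⟨c, hc, hb⟩ := hb
    rw [Bool.and_eq_true] at hb
    have h1 : n + c.2 ≤ T + 11 := Nat.le_of_ble_eq_true hb.1
    refine (hK c hc).of_isFlipped hb.2 _ (h.shift (n - 11) (by omega)) ?_
    change _ = window b 0 n % 2 ^ 11
    rw [window_mod _ hn']
    exact window_congr fun t _ => by rw [Nat.zero_add]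

theorem testBit_lor_two_pow (R z i : ℕ) :
    (Nat.lor R (Nat.pow 2 z)).testBit i = (R.testBit i || decide (z = i)) := by
  change (R ||| 2 ^ z).testBit i = _
  rw [Nat.testBit_or, Nat.testBit_two_pow]

/-- The search does not succeed along a good word: by induction, all tests fail that would cut off the
branch of this word. -/
theorem search_eq_false_of_isGoodBits {T : ℕ} {K : List (ℕ × ℕ)} (hK : ∀ c ∈ K, Excludes c.2 c.1)
    {b : ℕ → Bool} (hb : IsGoodBits b T) {fuel n R S : ℕ} (hn : n + fuel = T) (hn' : 11 ≤ n)
    (hR : ∀ j, j + 11 ≤ T → (j + n) % 2 = 0 → R.testBit (window b j 11) = false)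
    (hS : ∀ j, j + 11 ≤ T → (j + n) % 2 = 1 → S.testBit (window b j 11) = false) :
    search T K fuel n (window b 0 n) (revWindow b (n - 11)) R S = false := by
  induction fuel generalizing n R S with
  | zero => rfl
  | succ fuel ih =>
    have hvisit : ∀ x z, x = window b 0 (n + 1) → z = revWindow b (n - 10) →
        visit (search T K fuel) n R S x z = false := by
      rintro x z rfl rfl
      unfold visit
      simp only [evalThen_eq]
      rw [hb.hasBadSuffix_eq_false (by omega), Bool.cond_false, show n - 10 = n + 1 - 11 by omega]
      -- the reversed last window becomes forbidden at positions of its parity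
      refine ih (by omega) (by omega) (fun j hj hj2 => hS j hj (by omega)) fun j hj hj2 => ?_
      rw [testBit_lor_two_pow, hR j hj (by omega), Bool.false_or, decide_eq_false_iff_not]
      exact (hb.window_ne_revWindow hj (by omega) (by omega)).symm
    have hdef : search T K (fuel + 1) n (window b 0 n) (revWindow b (n - 11)) R S =
        cond (isExcluded T K n (window b 0 n)) true
          (evalThen ((R >>> (2 * (window b 0 n % 1024))) % 4) fun t =>
            cond (cond (Nat.beq (t % 2) 1) true (visit (search T K fuel) n R S
                (2 * window b 0 n) (revWindow b (n - 11) / 2)))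
              (cond (Nat.ble 2 t) true (visit (search T K fuel) n R S
                (Nat.succ (2 * window b 0 n)) (revWindow b (n - 11) / 2 + 1024))) false) := rfl
    rw [hdef, hb.isExcluded_eq_false hn' hK, Bool.cond_false, evalThen_eq,
      show window b 0 n % 1024 = window b (n - 10) 10 from window_mod b (by omega : 10 ≤ n)]
    -- the two bits of `t` tell whether the two continuations of the last ten bits are forbidden
    set t := (R >>> (2 * window b (n - 10) 10)) % 4 with ht
    have hx : window b 0 (n + 1) = 2 * window b 0 n + (b n).toNat := by
      rw [window_succ, Nat.zero_add]
    have hz : revWindow b (n - 10) = revWindow b (n - 11) / 2 + 1024 * (b n).toNat := by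
      rw [show n - 10 = n - 11 + 1 by omega, revWindow_succ, show n - 11 + 11 = n by omega]
    have hw : window b (n - 10) 11 = 2 * window b (n - 10) 10 + (b n).toNat := by
      rw [window_succ, show n - 10 + 10 = n by omega]
    have hfree := hR (n - 10) (by omega) (by omega)
    cases hbn : b n
    · rw [hbn] at hx hz hw
      have h0 : Nat.beq (t % 2) 1 = false := by
        rw [Bool.eq_false_iff]
        intro h1
        have h1 := Nat.eq_of_beq_eq_true h1
        have h2 : (R >>> (2 * window b (n - 10) 10)).testBit 0 = true := by
          rw [Nat.testBit_zero, decide_eq_true_eq]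
          omega
        rw [Nat.testBit_shiftRight] at h2
        change R.testBit (2 * window b (n - 10) 10 + false.toNat) = true at h2
        rw [← hw, hfree] at h2
        exact Bool.false_ne_true h2
      rw [h0, Bool.cond_false, hvisit (2 * window b 0 n) (revWindow b (n - 11) / 2) hx.symm hz.symm,
        Bool.cond_false]
    · rw [hbn] at hx hz hw
      have h0 : Nat.ble 2 t = false := by
        rw [Bool.eq_false_iff]
        intro h1
        have h1 := Nat.le_of_ble_eq_true h1
        have h2 : (R >>> (2 * window b (n - 10) 10)).testBit 1 = true := by
          rw [Nat.testBit_succ, Nat.testBit_zero, decide_eq_true_eq]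
          omega
        rw [Nat.testBit_shiftRight] at h2
        change R.testBit (2 * window b (n - 10) 10 + true.toNat) = true at h2
        rw [← hw, hfree] at h2
        exact Bool.false_ne_true h2
      rw [h0, Bool.cond_false, hvisit (Nat.succ (2 * window b 0 n))
        (revWindow b (n - 11) / 2 + 1024) hx.symm hz.symm, Bool.cond_self]

/-- The search for good words of length `T` that begin with the window `c`. -/
def searchFrom (T : ℕ) (K : List (ℕ × ℕ)) (c : ℕ) : Bool :=
  evalThen badWindows fun R => cond (R.testBit c) true
    (evalThen (window (fun t => c.testBit t) 0 11) fun z =>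
      evalThen (Nat.lor R (Nat.pow 2 z)) fun S => search T K (Nat.sub T 11) 11 c z R S)

theorem excludes_of_searchFrom {T : ℕ} {K : List (ℕ × ℕ)} {c : ℕ} (hT : 11 ≤ T)
    (hK : ∀ c ∈ K, Excludes c.2 c.1) (h : searchFrom T K c = true) : Excludes T c := by
  rintro b hb rfl
  unfold searchFrom at h
  simp only [evalThen_eq] at h
  have hz : window (fun t => (window b 0 11).testBit t) 0 11 = revWindow b 0 :=
    window_congr fun t ht => by
      rw [Nat.zero_add, testBit_window _ _ ht]
  rw [hb.testBit_badWindows (by omega), Bool.cond_false, hz] at h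
  have h' := search_eq_false_of_isGoodBits hK hb (fuel := T - 11) (n := 11) (R := badWindows)
    (S := Nat.lor badWindows (Nat.pow 2 (revWindow b 0))) (by omega) le_rfl
    (fun j hj _ => hb.testBit_badWindows hj) fun j hj hj2 => by
      rw [testBit_lor_two_pow, hb.testBit_badWindows hj, Bool.false_or, decide_eq_false_iff_not]
      exact (hb.window_ne_revWindow hj (by omega) (by omega)).symm
  exact Bool.false_ne_true (h'.symm.trans h)

/-! ### There is no good word of length 129 -/

/-- No good word of length 119 begins with this window, so that in the later searches a branch that
meets the window with at least 119 letters left to come from its start can be cut. -/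
theorem excludes_397 : Excludes 119 0b00110001101 :=
  excludes_of_searchFrom (K := []) (by norm_num) (by simp) (by decide +kernel)

theorem excludes_310 : Excludes 121 0b00100110110 :=
  excludes_of_searchFrom (K := [(0b00110001101, 119)]) (by norm_num)
    (by simpa using excludes_397) (by decide +kernel)

theorem excludes_454 : Excludes 125 0b00111000110 :=
  excludes_of_searchFrom (K := [(0b00110001101, 119), (0b00100110110, 121)]) (by norm_num)
    (by simpa using ⟨excludes_397, excludes_310⟩) (by decide +kernel)

theorem excludes_457 : Excludes 126 0b00111001001 :=
  excludes_of_searchFrom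
    (K := [(0b00110001101, 119), (0b00100110110, 121), (0b00111000110, 125)]) (by norm_num)
    (by simpa using ⟨excludes_397, excludes_310, excludes_454⟩) (by decide +kernel)

theorem excludes_of_lt {c : ℕ} (hc : c < 512) : Excludes 129 c := by
  have h : ((List.range 512).all fun c => searchFrom 129
      [(0b00110001101, 119), (0b00100110110, 121), (0b00111000110, 125), (0b00111001001, 126)] c) =
      true := by
    decide +kernel
  exact excludes_of_searchFrom (by norm_num)
    (by simpa using ⟨excludes_397, excludes_310, excludes_454, excludes_457⟩)
    (List.all_eq_true.1 h c (by simpa using hc))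

theorem not_isGoodBits (b : ℕ → Bool) : ¬ IsGoodBits b 129 := by
  intro hb
  -- the first two bits may be assumed to be unset
  have hb' := hb.flip (b 0) (b 1)
  refine excludes_of_lt (c := window (fun n => b n ^^ alternating (b 0) (b 1) n) 0 11) ?_ _ hb' rfl
  rw [show (11 : ℕ) = 2 + 9 from rfl, window_add]
  have h0 : window (fun n => b n ^^ alternating (b 0) (b 1) n) 0 2 = 0 := by
    change 2 * (2 * 0 + (b 0 ^^ alternating (b 0) (b 1) 0).toNat) +
      (b 1 ^^ alternating (b 0) (b 1) 1).toNat = 0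
    simp [alternating]
  rw [h0]
  simpa using window_lt (fun n => b n ^^ alternating (b 0) (b 1) n) (0 + 2) 9

/-! ### Dean words and their images -/

theorem isDeanWord_mono {L L' : Set (List (Fin 4))} (h : L' ⊆ L) (hL : IsDeanWord L) :
    IsDeanWord L' :=
  ⟨⟨fun hf => hL.1.1 (h hf), fun hf => hL.1.2.1 (h hf), fun hf => hL.1.2.2.1 (h hf),
    fun hf => hL.1.2.2.2 (h hf)⟩, fun v hv hf => hL.2 v hv (h hf)⟩

theorem isFreeWord_mono {α : Type*} {β : ℚ} {L L' : Set (List α)} (h : L' ⊆ L)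
    (hL : IsFreeWord β L) : IsFreeWord β L' := fun f hf => hL f (h hf)

theorem isDirectedWord_mono {α : Type*} {d : ℕ} {L L' : Set (List α)} (h : L' ⊆ L)
    (hL : IsDirectedWord d L) : IsDirectedWord d L' := fun f hf hd hr => hL f (h hf) hd (h hr)

theorem lowBit_of_adjacent : ∀ a b : Fin 4, a ≠ b → [a, b] ≠ [0, 2] → [a, b] ≠ [2, 0] →
    [a, b] ≠ [1, 3] → [a, b] ≠ [3, 1] → lowBit b = !lowBit a := by
  decide

theorem isGoodBits_of_isDeanWord {v : ℕ → Fin 4} {n : ℕ}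
    (h1 : IsDeanWord (wordFactors (prefixOf v n)))
    (h2 : IsFreeWord (27 / 16) (wordFactors (prefixOf v n)))
    (h3 : IsDirectedWord 11 (wordFactors (prefixOf v n))) :
    IsGoodBits (fun i => highBit (v i)) n := by
  have adj : ∀ i, i + 1 < n → lowBit (v (i + 1)) = !lowBit (v i) := by
    intro i hi
    have hf : [v i, v (i + 1)] ∈ wordFactors (prefixOf v n) :=
      mem_wordFactors_prefixOf.2 ⟨i, by simp only [List.length_cons, List.length_nil]; omega, rfl⟩
    refine lowBit_of_adjacent _ _ (fun he => ?_) (fun he => h1.1.1 (he ▸ hf))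
      (fun he => h1.1.2.1 (he ▸ hf)) (fun he => h1.1.2.2.1 (he ▸ hf))
      (fun he => h1.1.2.2.2 (he ▸ hf))
    rw [← he] at hf
    exact h1.2 [v i] (by simp) hf
  have low : ∀ i, i < n → lowBit (v i) = (lowBit (v 0) ^^ decide (i % 2 = 1)) := by
    intro i hi
    induction i with
    | zero => simp
    | succ i ih =>
      rw [adj i hi, ih (by omega)]
      rcases Nat.mod_two_eq_zero_or_one i with h | h
      · simp [h, show (i + 1) % 2 = 1 by omega]
      · simp [h, show (i + 1) % 2 = 0 by omega]
  have eq : ∀ i j, i < n → j < n → i % 2 = j % 2 → highBit (v i) = highBit (v j) → v i = v j := by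
    intro i j hi hj hij h
    refine eq_of_bits_eq ?_ h
    rw [low i hi, low j hj, hij]
  constructor
  · intro i p l hp2 hp hl he hm
    obtain ⟨f, hf, hfl, hper⟩ := exists_factor_of_matches hl fun t ht =>
      eq (i + t) (i + t + p) (by omega) (by omega) (by omega) (hm t ht)
    have h := h2 f hf p hp hper
    have hp' : (0 : ℚ) < p := by exact_mod_cast hp
    rw [hfl, div_lt_iff₀ hp'] at h
    have he' : (11 * p : ℚ) ≤ 16 * l := by exact_mod_cast he
    push_cast at h
    linarith
  · intro i j hi hj hij hr
    have mem : ∀ k, k + 11 ≤ n → prefixOf (fun t => v (k + t)) 11 ∈ wordFactors (prefixOf v n) :=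
      fun k hk => mem_wordFactors_prefixOf.2 ⟨k, by simpa using hk, by simp⟩
    refine h3 _ (mem j hj) (by simp) ?_
    rw [eq_prefixOf (w := (prefixOf (fun t => v (j + t)) 11).reverse) (v := fun t => v (i + t))
      (n := 11) (by simp) fun t ht => ?_]
    · exact mem i hi
    · rw [List.getElem?_reverse (by simpa using ht), length_prefixOf,
        getElem?_prefixOf _ (by omega)]
      rw [show 11 - 1 - t = 10 - t by omega]
      exact congrArg some (eq _ _ (by omega) (by omega) (by omega) (hr t ht)).symm

theorem not_isDirectedWord_of_isDeanWord {v : ℕ → Fin 4}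
    (h1 : IsDeanWord (wordFactors (prefixOf v 129)))
    (h2 : IsFreeWord (27 / 16) (wordFactors (prefixOf v 129))) :
    ¬ IsDirectedWord 11 (wordFactors (prefixOf v 129)) :=
  fun h3 => not_isGoodBits _ (isGoodBits_of_isDeanWord h1 h2 h3)

theorem exists_eq_prefixOf (w : List (Fin 4)) : ∃ v, w = prefixOf v w.length :=
  ⟨fun i => w.getD i 0, eq_prefixOf rfl fun i hi => by simp [hi]⟩

theorem deanImage_properties {u : ℕ → Fin 4} {n : ℕ}
    (hu : IsPlusFreeWord (7 / 5) (wordFactors (prefixOf u n))) :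
    IsDeanWord (wordFactors (prefixOf (deanImage u) (564 * n))) ∧
      IsPlusFreeWord (27 / 16) (wordFactors (prefixOf (deanImage u) (564 * n))) ∧
      IsDirectedWord 10 (wordFactors (prefixOf (deanImage u) (564 * n))) :=
  have h := isPlusFreeWord_deanImage hu
  ⟨⟨isReducedWord_deanImage u _, h.isSquareFreeWord (by norm_num)⟩, h,
    isDirectedWord_deanImage u _⟩

theorem infImage_properties {u : ℕ → Fin 4} (hu : IsPlusFreeWord (7 / 5) (infFactors u)) :
    IsDeanWord (infFactors (infImage deanMorphism u)) ∧
      IsPlusFreeWord (27 / 16) (infFactors (infImage deanMorphism u)) ∧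
      IsDirectedWord 10 (infFactors (infImage deanMorphism u)) := by
  have h : ∀ n, IsPlusFreeWord (27 / 16) (wordFactors (prefixOf (deanImage u) n)) := fun n =>
    isPlusFreeWord_mono (wordFactors_prefixOf_mono _ (by omega))
      (isPlusFreeWord_deanImage (n := n)
        (isPlusFreeWord_mono (wordFactors_prefixOf_subset u n) hu))
  rw [infImage_deanMorphism]
  exact ⟨isDeanWord_infFactors fun n =>
      ⟨isReducedWord_deanImage u n, (h n).isSquareFreeWord (by norm_num)⟩,
    isPlusFreeWord_infFactors h, isDirectedWord_infFactors fun n => isDirectedWord_deanImage u n⟩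

theorem mainTheorem12 :
    -- the morphism is 564-uniform
    (∀ a : Fin 4, (deanMorphism a).length = 564) ∧
    -- there is an infinite word as desired, and it is the image of a 7/5⁺-free 4-ary word
    (∃ w : ℕ → Fin 4,
      (IsDeanWord (infFactors w) ∧ IsPlusFreeWord (27 / 16) (infFactors w) ∧
        IsDirectedWord 10 (infFactors w)) ∧
      ∃ u : ℕ → Fin 4, IsPlusFreeWord (7 / 5) (infFactors u) ∧ w = infImage deanMorphism u) ∧
    -- the image of any 7/5⁺-free 4-ary word, infinite or finite, is as desired
    (∀ u : ℕ → Fin 4, IsPlusFreeWord (7 / 5) (infFactors u) →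
      IsDeanWord (infFactors (infImage deanMorphism u)) ∧
      IsPlusFreeWord (27 / 16) (infFactors (infImage deanMorphism u)) ∧
      IsDirectedWord 10 (infFactors (infImage deanMorphism u))) ∧
    (∀ u : List (Fin 4), IsPlusFreeWord (7 / 5) (wordFactors u) →
      IsDeanWord (wordFactors (wordImage deanMorphism u)) ∧
      IsPlusFreeWord (27 / 16) (wordFactors (wordImage deanMorphism u)) ∧
      IsDirectedWord 10 (wordFactors (wordImage deanMorphism u))) ∧
    -- a 27/16-free 11-directed Dean word is finite, of length below 129
    (∀ w : List (Fin 4), IsDeanWord (wordFactors w) → IsFreeWord (27 / 16) (wordFactors w) →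
      IsDirectedWord 11 (wordFactors w) → w.length < 129) ∧
    (∀ w : ℕ → Fin 4, IsDeanWord (infFactors w) → IsFreeWord (27 / 16) (infFactors w) →
      ¬ IsDirectedWord 11 (infFactors w)) := by
  refine ⟨length_deanMorphism, ⟨infImage deanMorphism (pansiotWord pansiotCode),
    infImage_properties isPlusFreeWord_pansiotWord, _, isPlusFreeWord_pansiotWord, rfl⟩,
    fun u hu => infImage_properties hu, fun u hu => ?_, fun w h1 h2 h3 => ?_, fun w h1 h2 h3 => ?_⟩
  · obtain ⟨v, hv⟩ := exists_eq_prefixOf u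
    rw [hv] at hu ⊢
    rw [wordImage_prefixOf]
    exact deanImage_properties hu
  · by_contra hw
    obtain ⟨v, hv⟩ := exists_eq_prefixOf w
    have hsub : wordFactors (prefixOf v 129) ⊆ wordFactors w := by
      rw [hv]
      exact wordFactors_prefixOf_mono v (by omega)
    exact not_isDirectedWord_of_isDeanWord (isDeanWord_mono hsub h1) (isFreeWord_mono hsub h2)
      (isDirectedWord_mono hsub h3)
  · have hsub := wordFactors_prefixOf_subset w 129
    exact not_isDirectedWord_of_isDeanWord (isDeanWord_mono hsub h1) (isFreeWord_mono hsub h2)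
      (isDirectedWord_mono hsub h3)
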